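/- **Setting.** Fix $D>0$, $\Delta>0$, mean angles $\theta_1$ (Bob), $\theta_2$ (Ava) with $[\theta_k-\Delta,\theta_k+\Delta]\subseteq[-\pi/3,\pi/3]$, integers $1\le L\le s\le N$, and $s$ distinct subcarriers $p_1,\dots,p_s\in\{0,\dots,N-1\}$. For $N_T$ antennas let $$[\mathbf R_k]_{m,n}=\frac1{2\Delta L}\int_{\theta_k-\Delta}^{\theta_k+\Delta}e^{-j2\pi D(m-n)\sin\theta}\,d\theta ,\qquad k=1,2,\quad 1\le m,n\le N_T .$$ Let $\mathbf F$ be the $s\times L$ matrix with entries $e^{-2\pi j p_k l/N}$ ($0\le l<L$), $\mathbf R_F=\mathbf F^*\mathbf F^T$, and $\overline{\mathbf R}_F$ its Moore–Penrose inverse. Write $\mathbf R_1=\mathbf U\,\mathrm{diag}(\lambda_i)\,\mathbf U^H$. Fix $c>0$ and thresholds $\tau_{N_T}\ge c$. Let $\rho_1$ be the number of (significant) eigenvalues $\lambda_i\ge\tau_{N_T}$, and $\overline{\mathbf R}_1=\mathbf U\,\mathrm{diag}(\overline\lambda_i)\,\mathbf U^H$ with $\overline\lambda_i=1/\lambda_i$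 for these eigenvalues and $\overline\lambda_i=0$ for the others. For a row vector $\mathbf r\in\mathbb C^{N_Ts}$ put $f(\mathbf r)=\mathbf r(\overline{\mathbf R}_1\otimes\overline{\mathbf R}_F)\mathbf r^H$. The channels are $$\mathbf h_B=\mathbf g_B(\mathbf R_1^{1/2}\otimes\mathbf F^T),\qquad \mathbf h_A=\mathbf g_A(\mathbf R_2^{1/2}\otimes\mathbf F^T),$$ where $\mathbf g_B,\mathbf g_A\in\mathbb C^{1\times N_TL}$ have i.i.d. $\mathcal{CN}(0,1)$ entries. For estimates $\hat{\mathbf h}_B,\hat{\mathbf h}_A$ let $\Delta f=f(\hat{\mathbf h}_B)-f(\hat{\mathbf h}_A)$. No assumption is made on the joint law for different values of $N_T$. **Theorem 3.** As $N_T\to\infty$, $\Delta f$ is asymptotically equivalent to $L\{\rho_1-\mathrm{Tr}(\mathbf R_2\overline{\mathbf R}_1)\}$ on the scale $N_Ts$, that is, almost surely $$\frac{\Delta f-L\{\rho_1-\mathrm{Tr}(\mathbf R_2\overline{\mathbf R}_1)\}}{N_Ts}\longrightarrow 0 ,$$ in each of the following two situations. 1. *(Estimates from the received signal, high SNR.)*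 Let $\mathbf X=[\mathbf x_1\ \mathbf x_2]$ be an invertible $2\times2$ pilot matrix with $\mathbf x_1=\sqrt{\rho_B}\,(e^{j\phi_0},e^{j\phi_1})^T$, $\mathbf x_2=\sqrt{\rho_A}\,(e^{j\psi_0},e^{j\psi_1})^T$, $\rho_B,\rho_A>0$. Let $\mathbf Y=\mathbf X\begin{bmatrix}\mathbf h_B\\ \mathbf h_A\end{bmatrix}+\sigma\mathbf Z$, where for each $N_T$ all the entries of $\mathbf g_B,\mathbf g_A,\mathbf Z$ are i.i.d. $\mathcal{CN}(0,1)$. Put $\mathbf C=\frac1{N_Ts}\mathbf Y\mathbf Y^H$, $T_k=\frac{\mathrm{Tr}(\mathbf R_k)\mathrm{Tr}(\mathbf R_F)}{N_Ts}$, $\hat{\mathbf h}_B=T_1\mathbf x_1^H\mathbf C^{-1}\mathbf Y$ and $\hat{\mathbf h}_A=T_2\mathbf x_2^H\mathbf C^{-1}\mathbf Y$. Then, almost surely, the convergence holds as $N_T\to\infty$ and $\sigma\to0$, $\sigma\ge0$, jointly. 2. *(Gaussian estimation errors of equal mean square.)* Let $\hat{\mathbf h}_B=\mathbf h_B-\varepsilon\mathbf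 h$ and $\hat{\mathbf h}_A=\mathbf h_A-\varepsilon\mathbf h'$, where $\mathbf h,\mathbf h'$ have i.i.d. $\mathcal{CN}(0,1)$ entries, $\mathbf h$ is independent of $\mathbf g_B$, $\mathbf h'$ is independent of $\mathbf g_A$, and the real numbers $\varepsilon=\varepsilon_{N_T}$ are bounded. Then, almost surely, the convergence holds as $N_T\to\infty$. -/

import Mathlib

open MeasureTheory ProbabilityTheory Filter Topology
open scoped Matrix Kronecker

noncomputable section

namespace PilotID

/-- The circularly symmetric complex Gaussian law `CN(0,1)`: real and imaginary parts are
independent, centred, of variance `1/2`. -/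
def cn01 : Measure ℂ :=
  ((gaussianReal 0 (1 / 2)).prod (gaussianReal 0 (1 / 2))).map (fun p => (⟨p.1, p.2⟩ : ℂ))

/-- The family `X` consists of i.i.d. `CN(0,1)` random variables. -/
def IsIIDCN {Ω ι : Type*} [MeasurableSpace Ω] (X : ι → Ω → ℂ) (μ : Measure Ω) : Prop :=
  (∀ i, HasLaw (X i) cn01 μ) ∧ iIndepFun X μ

/-- The one-ring covariance matrix of `n` antennas of spacing `D` wavelengths, mean angle of
arrival `θ`, angular spread `Δ`, for each of `L` equally strong paths. -/
def ringCov (D Δ : ℝ) (L : ℕ) (θ : ℝ) (n : ℕ) : Matrix (Fin n) (Fin n) ℂ :=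
  Matrix.of fun a b => (1 / (2 * Δ * L) : ℂ) * ∫ t in (θ - Δ)..(θ + Δ),
    Complex.exp (-Complex.I * 2 * Real.pi * D * ((a : ℂ) - (b : ℂ)) * Real.sin t)

theorem ringCov_isHermitian (D Δ : ℝ) (L : ℕ) (θ : ℝ) (n : ℕ) :
    (ringCov D Δ L θ n).IsHermitian := by
  ext a b
  simp only [ringCov, Matrix.conjTranspose_apply, Matrix.of_apply, RCLike.star_def, map_mul]
  congr 1
  · simp [map_ofNat]
  · simp only [intervalIntegral.intervalIntegral_eq_integral_uIoc, Complex.real_smul, map_mul,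
      Complex.conj_ofReal, ← integral_conj, ← Complex.exp_conj]
    congr 2
    ext t
    congr 1
    simp only [map_neg, map_sub, Complex.conj_I, map_natCast,
      map_ofNat]
    ring

/-- The rows, indexed by the subcarriers `p 0, …, p (s-1)`, of the first `L` columns of the
unnormalized DFT matrix of size `N`. -/
def dftRows (N L : ℕ) {s : ℕ} (p : Fin s → Fin N) : Matrix (Fin s) (Fin L) ℂ :=
  Matrix.of fun k l => Complex.exp (-Complex.I * 2 * Real.pi * (p k : ℕ) * (l : ℕ) / N)

/-- The frequency covariance `R_F = F^* F^T`. -/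
def freqCov {s L : ℕ} (F : Matrix (Fin s) (Fin L) ℂ) : Matrix (Fin s) (Fin s) ℂ :=
  (Fᵀ)ᴴ * Fᵀ

theorem freqCov_isHermitian {s L : ℕ} (F : Matrix (Fin s) (Fin L) ℂ) :
    (freqCov F).IsHermitian :=
  Matrix.isHermitian_conjTranspose_mul_self _

/-- `U diag(√λ) U^H` for a Hermitian matrix `A = U diag(λ) U^H`: the positive semidefinite square
root when `A` is positive semidefinite. -/
def hermSqrt {n : ℕ} {A : Matrix (Fin n) (Fin n) ℂ} (hA : A.IsHermitian) :
    Matrix (Fin n) (Fin n) ℂ :=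
  hA.cfc Real.sqrt

/-- `U diag(λ̄) U^H` for a Hermitian matrix `A = U diag(λ) U^H`, where `λ̄ = 1/λ` on the eigenvalues
`λ ≥ τ` and `λ̄ = 0` on the others. -/
def truncInv {n : ℕ} {A : Matrix (Fin n) (Fin n) ℂ} (hA : A.IsHermitian) (τ : ℝ) :
    Matrix (Fin n) (Fin n) ℂ :=
  hA.cfc (fun x => if τ ≤ x then x⁻¹ else 0)

/-- The number, with multiplicity, of the eigenvalues `λ ≥ τ` of a Hermitian matrix. -/
def effRank {n : ℕ} {A : Matrix (Fin n) (Fin n) ℂ} (hA : A.IsHermitian) (τ : ℝ) : ℕ :=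
  (Finset.univ.filter fun i => τ ≤ hA.eigenvalues i).card

/-- `U diag(λ̄) U^H` for a Hermitian matrix `A = U diag(λ) U^H`, where `λ̄ = 1/λ` if `λ ≠ 0` and
`λ̄ = 0` if `λ = 0`: the Moore-Penrose inverse. -/
def pseudoInv {n : ℕ} {A : Matrix (Fin n) (Fin n) ℂ} (hA : A.IsHermitian) :
    Matrix (Fin n) (Fin n) ℂ :=
  hA.cfc (fun x => x⁻¹)

/-- The frequency-selective channel, a row vector `g (R^{1/2} ⊗ F^T)`. -/
def fsChannel {n s L : ℕ} {R : Matrix (Fin n) (Fin n) ℂ} (hR : R.IsHermitian)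
    (F : Matrix (Fin s) (Fin L) ℂ) (g : Fin n × Fin L → ℂ) : Fin n × Fin s → ℂ :=
  g ᵥ* (hermSqrt hR ⊗ₖ Fᵀ)

/-- The `2 × 2` pilot matrix: rows are the two symbol times, column `0` is Bob's pilot vector
(power `ρB`, phases `φ`), column `1` is Ava's (power `ρA`, phases `ψ`). -/
def pilots (ρB ρA : ℝ) (φ ψ : Fin 2 → ℝ) : Matrix (Fin 2) (Fin 2) ℂ :=
  Matrix.of fun k j =>
    if j = 0 then (Real.sqrt ρB : ℂ) * Complex.exp (Complex.I * φ k)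
    else (Real.sqrt ρA : ℂ) * Complex.exp (Complex.I * ψ k)

/-- The received signal `Y = X H + σ Z`, where the rows of `H` are Bob's and Ava's channels. -/
def received {n s : ℕ} (X : Matrix (Fin 2) (Fin 2) ℂ) (hB hA : Fin n × Fin s → ℂ) (σ : ℝ)
    (Z : Fin 2 × (Fin n × Fin s) → ℂ) : Matrix (Fin 2) (Fin n × Fin s) ℂ :=
  X * Matrix.of ![hB, hA] + (σ : ℂ) • Matrix.of fun k a => Z (k, a)

/-- The sample covariance matrix `C_Y = Y Y^H / (n s)`. -/
def sampleCov {n s : ℕ} (Y : Matrix (Fin 2) (Fin n × Fin s) ℂ) : Matrix (Fin 2) (Fin 2) ℂ :=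
  (1 / ((n : ℂ) * (s : ℂ))) • (Y * Yᴴ)

/-- The channel estimate `W Y` with `W = T x^H C_Y⁻¹`, `T = Tr(R) Tr(R_F) / (n s)`, for the pilot
vector `x` and the spatial covariance `R`. -/
def estimate {n s : ℕ} (R : Matrix (Fin n) (Fin n) ℂ) (RF : Matrix (Fin s) (Fin s) ℂ)
    (x : Fin 2 → ℂ) (Y : Matrix (Fin 2) (Fin n × Fin s) ℂ) : Fin n × Fin s → ℂ :=
  ((R.trace * RF.trace / ((n : ℂ) * (s : ℂ))) • (star x ᵥ* (sampleCov Y)⁻¹)) ᵥ* Y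

/-- The measure `f(r) = r (R̄₁ ⊗ R̄_F) r^H` of a row vector `r`. -/
def fMeasure {n s : ℕ} (R1bar : Matrix (Fin n) (Fin n) ℂ) (RFbar : Matrix (Fin s) (Fin s) ℂ)
    (r : Fin n × Fin s → ℂ) : ℂ :=
  (r ᵥ* (R1bar ⊗ₖ RFbar)) ⬝ᵥ star r

/-- The error decision function, `Δf = f(hatB) - f(hatA)`, for spatial covariance `R₁` with
eigenvalue threshold `τ`. -/
def deltaF {n s L : ℕ} {R1 : Matrix (Fin n) (Fin n) ℂ} (hR1 : R1.IsHermitian) (τ : ℝ)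
    (F : Matrix (Fin s) (Fin L) ℂ) (hatB hatA : Fin n × Fin s → ℂ) : ℂ :=
  fMeasure (truncInv hR1 τ) (pseudoInv (freqCov_isHermitian F)) hatB -
    fMeasure (truncInv hR1 τ) (pseudoInv (freqCov_isHermitian F)) hatA

/-- The claimed value `L (ρ₁ - Tr(R₂ R̄₁))`. -/
def deltaFLimit {n : ℕ} (L : ℕ) {R1 : Matrix (Fin n) (Fin n) ℂ} (hR1 : R1.IsHermitian) (τ : ℝ)
    (R2 : Matrix (Fin n) (Fin n) ℂ) : ℂ :=
  (L : ℂ) * ((effRank hR1 τ : ℂ) - (R2 * truncInv hR1 τ).trace)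

end PilotID

end

namespace PilotID

/-! Every row that enters `f` is a combination, with finitely many bounded coefficients, of rows `X
T_a`, where `X` is one Gaussian vector of size O(n) and the matrices `T_a` are uniformly bounded
with mutually orthogonal ranges. So everything reduces to the forms `X (T_a Q T_bᴴ) Xᴴ`. Such a form
has mean `tr (T_a Q T_bᴴ)`, which is zero for `a ≠ b`, and its matrix has squared Frobenius norm
O(n). After diagonalization a centred Hermitian form is `∑ λ_i (|Y_i|² - 1)` with independent `Y_i`,
so its fourth moment is O(n²). Divided by n, the fourth moments are summable, which gives almost
sure convergence whatever the coupling between sizes (`tendsto_quadForm`, `tendsto_gram`).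

The uniform bounds come from `c` for the truncated inverse and, for the ring covariances, from the
bounded density of `D sin t` on `|t| ≤ π/3` (`exists_eigenvalues_ringCov_le`). The means are
explicit: the DFT rows have full column rank, hence `Fᵀ R̄_F (Fᵀ)ᴴ = 1`
(`dftRows_mul_pseudoInv_mul`), and the two channels contribute `L ρ₁` and `L tr(R₂ R̄₁)`.

For Gaussian errors both users acquire the same extra mean `ε² tr(R̄₁ ⊗ R̄_F)`, which cancels in the
difference. For the received signal, the normalized Gram matrix of channels and noise tends to the
identity, so the random combiner `x_jᴴ C⁻¹ [X σI]` tends to the coordinate vector of user `j`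
(`tendsto_combiner`), and the estimate may be replaced by the true channel. -/

/-! ### The law `CN(0,1)`: characteristic function and moments. -/

theorem cn01_eq_map_equivRealProdCLM :
    cn01 = ((gaussianReal 0 (1 / 2)).prod (gaussianReal 0 (1 / 2))).map
      (Complex.equivRealProdCLM.symm : (ℝ × ℝ) →L[ℝ] ℂ) := by
  rw [cn01]
  congr 1

instance isGaussian_cn01 : IsGaussian cn01 := by
  rw [cn01_eq_map_equivRealProdCLM]
  infer_instance

theorem measurable_mk_complex : Measurable (fun p : ℝ × ℝ => (⟨p.1, p.2⟩ : ℂ)) :=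
  Complex.measurableEquivRealProd.symm.measurable

theorem charFun_cn01 (t : ℂ) : charFun cn01 t = Complex.exp (-(‖t‖ ^ 2 / 4 : ℝ)) := by
  rw [charFun_apply, cn01, integral_map measurable_mk_complex.aemeasurable (by fun_prop)]
  have h : ∀ p : ℝ × ℝ, Complex.exp ((inner ℝ (⟨p.1, p.2⟩ : ℂ) t : ℝ) * Complex.I) =
      Complex.exp (t.re * p.1 * Complex.I) * Complex.exp (t.im * p.2 * Complex.I) := by
    intro p
    rw [← Complex.exp_add, Complex.inner]
    congr 1
    simp
    ring
  simp_rw [h]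
  rw [integral_prod_mul (fun x : ℝ => Complex.exp (t.re * x * Complex.I))
    (fun x : ℝ => Complex.exp (t.im * x * Complex.I)), ← charFun_apply_real, ← charFun_apply_real,
    charFun_gaussianReal, charFun_gaussianReal, ← Complex.exp_add, Complex.sq_norm,
    Complex.normSq_apply]
  congr 1
  push_cast
  ring

theorem integral_normSq_cn01 : ∫ z, ‖z‖ ^ 2 ∂cn01 = 1 := by
  rw [cn01, integral_map measurable_mk_complex.aemeasurable (by fun_prop)]
  have h2 : ∫ x, x ^ 2 ∂(gaussianReal 0 (1 / 2)) = 1 / 2 := by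
    have := variance_id_gaussianReal (μ := 0) (v := 1 / 2)
    rw [variance_eq_integral (by fun_prop)] at this
    simpa using this
  have hi : Integrable (fun x : ℝ => x ^ 2) (gaussianReal 0 (1 / 2)) :=
    (memLp_id_gaussianReal (μ := 0) (v := 1 / 2) 2).integrable_sq
  simp only [Complex.sq_norm, Complex.normSq_mk]
  rw [integral_add]
  · simp_rw [← pow_two]
    rw [integral_fun_fst (fun x : ℝ => x ^ 2), integral_fun_snd (fun x : ℝ => x ^ 2), h2]
    norm_num
  · simpa only [pow_two] using hi.comp_fst (ν := gaussianReal 0 (1 / 2))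
  · simpa only [pow_two] using hi.comp_snd (μ := gaussianReal 0 (1 / 2))

theorem integrable_norm_pow_cn01 (k : ℕ) : Integrable (fun z : ℂ => ‖z‖ ^ k) cn01 := by
  rcases Nat.eq_zero_or_pos k with rfl | hk
  · simp
  · exact (IsGaussian.memLp_id cn01 k (by simp)).integrable_norm_pow hk.ne'

/-! ### Unitary invariance of i.i.d. `CN(0,1)` families. -/

section iid

variable {Ω ι κ : Type*} [MeasurableSpace Ω] {μ : Measure Ω}

theorem IsIIDCN.precomp {X : ι → Ω → ℂ} (h : IsIIDCN X μ) {e : κ → ι}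
    (he : Function.Injective e) : IsIIDCN (fun k => X (e k)) μ :=
  ⟨fun k => h.1 (e k), h.2.precomp he⟩

/-- Marginal laws and independence are packed into a single identity that sees `t` only through its
Euclidean norm, which makes unitary invariance immediate. -/
theorem isIIDCN_iff_charFun [Fintype ι] [IsProbabilityMeasure μ] {X : ι → Ω → ℂ}
    (hX : ∀ i, AEMeasurable (X i) μ) :
    IsIIDCN X μ ↔ ∀ t : ι → ℂ, ∫ ω, Complex.exp ((∑ i, inner ℝ (X i ω) (t i) : ℝ) * Complex.I) ∂μ
      = Complex.exp (-((∑ i, ‖t i‖ ^ 2) / 4 : ℝ)) := by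
  classical
  have joint : ∀ t : PiLp 2 (fun _ : ι => ℂ), charFun (μ.map (fun ω => WithLp.toLp 2 (X · ω))) t =
      ∫ ω, Complex.exp ((∑ i, inner ℝ (X i ω) (t i) : ℝ) * Complex.I) ∂μ := by
    intro t
    rw [charFun_apply, integral_map (by fun_prop) (by fun_prop)]
    rfl
  constructor
  · rintro ⟨h1, h2⟩ t
    have := (iIndepFun_iff_charFun_pi hX).1 h2 (WithLp.toLp 2 t)
    rw [joint] at this
    refine this.trans ?_
    simp_rw [(h1 _).map_eq, charFun_cn01]
    rw [← Complex.exp_sum]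
    congr 1
    push_cast
    rw [Finset.sum_neg_distrib, Finset.sum_div]
  · intro h
    -- A test vector supported at one coordinate isolates the marginal there.
    have marg : ∀ i, μ.map (X i) = cn01 := by
      intro i
      have : IsProbabilityMeasure (μ.map (X i)) := Measure.isProbabilityMeasure_map (hX i)
      refine Measure.ext_of_charFun (funext fun t => ?_)
      have := h (Pi.single i t)
      rw [charFun_cn01, charFun_apply, integral_map (hX i) (by fun_prop)]
      have e1 : ∀ ω, ∑ j, inner ℝ (X j ω) ((Pi.single i t : ι → ℂ) j) = inner ℝ (X i ω) t := by
        intro ω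
        rw [Finset.sum_eq_single i (fun j _ hj => by simp [hj]) (by simp)]
        simp
      have e2 : ∑ j, ‖(Pi.single i t : ι → ℂ) j‖ ^ 2 = ‖t‖ ^ 2 := by
        rw [Finset.sum_eq_single i (fun j _ hj => by simp [hj]) (by simp)]
        simp
      simp_rw [e1, e2] at this
      exact this
    refine ⟨fun i => ⟨hX i, marg i⟩, (iIndepFun_iff_charFun_pi hX).2 fun t => ?_⟩
    rw [joint, h]
    simp_rw [marg, charFun_cn01]
    rw [← Complex.exp_sum]
    congr 1
    push_cast
    rw [Finset.sum_neg_distrib, Finset.sum_div]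

theorem sum_normSq_mulVec_of_unitary {ι : Type*} [Fintype ι] [DecidableEq ι] {U : Matrix ι ι ℂ}
    (hU : Uᴴ * U = 1) (v : ι → ℂ) : ∑ i, ‖(U *ᵥ v) i‖ ^ 2 = ∑ i, ‖v i‖ ^ 2 := by
  have key : ∀ w : ι → ℂ, ((∑ i, ‖w i‖ ^ 2 : ℝ) : ℂ) = star w ⬝ᵥ w := by
    intro w
    simp [dotProduct, ← Complex.conj_mul']
  have : ((∑ i, ‖(U *ᵥ v) i‖ ^ 2 : ℝ) : ℂ) = ((∑ i, ‖v i‖ ^ 2 : ℝ) : ℂ) := by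
    rw [key, key, Matrix.star_mulVec, ← Matrix.dotProduct_mulVec, Matrix.mulVec_mulVec, hU,
      Matrix.one_mulVec]
  exact_mod_cast this

theorem IsIIDCN.vecMul_unitary [Fintype ι] [DecidableEq ι] [IsProbabilityMeasure μ]
    {X : ι → Ω → ℂ} (h : IsIIDCN X μ) {U : Matrix ι ι ℂ} (hU : U ∈ Matrix.unitaryGroup ι ℂ) :
    IsIIDCN (fun i ω => ((X · ω) ᵥ* U) i) μ := by
  have hX : ∀ i, AEMeasurable (X i) μ := fun i => (h.1 i).aemeasurable
  rw [isIIDCN_iff_charFun (fun i => ?_)]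
  · intro t
    -- The unitary is moved onto the test vector as the entrywise conjugate of `U`, which is again
    -- unitary and so preserves its norm.
    have e : ∀ ω, ∑ i, inner ℝ (((X · ω) ᵥ* U) i) (t i) =
        ∑ j, inner ℝ (X j ω) ((U.map star *ᵥ t) j) := by
      intro ω
      simp only [Complex.inner, ← Complex.re_sum]
      congr 1
      simp only [Matrix.vecMul, Matrix.mulVec, dotProduct, map_sum, map_mul, Finset.sum_mul,
        Finset.mul_sum, Matrix.map_apply]
      rw [Finset.sum_comm]
      refine Finset.sum_congr rfl fun j _ => Finset.sum_congr rfl fun i _ => ?_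
      simp only [RCLike.star_def]
      ring
    simp_rw [e]
    rw [(isIIDCN_iff_charFun hX).1 h, sum_normSq_mulVec_of_unitary]
    have h1 := (Matrix.mem_unitaryGroup_iff').1 hU
    have h2 := congrArg (fun M : Matrix ι ι ℂ => M.map star) h1
    ext i j
    have h3 := congrFun (congrFun h2 i) j
    simp only [Matrix.map_apply, Matrix.mul_apply, Matrix.star_eq_conjTranspose,
      Matrix.conjTranspose_apply, star_sum, star_mul', star_star] at h3 ⊢
    rw [h3]
    by_cases hij : i = j <;> simp [Matrix.one_apply, hij]
  · simp only [Matrix.vecMul, dotProduct]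
    fun_prop

end iid

/-! ### Fourth moments and almost sure concentration of Gaussian quadratic forms. -/

/-- Second and fourth moments of a sum of independent centred random variables. -/
theorem moments_sum_of_iIndepFun {Ω ι : Type*} [MeasurableSpace Ω] {μ : Measure Ω}
    [IsProbabilityMeasure μ] {η : ι → Ω → ℝ} {v : ι → ℝ} {K : ℝ} (hK : 1 ≤ K)
    (hmeas : ∀ i, AEMeasurable (η i) μ) (hind : iIndepFun η μ)
    (hint : ∀ i k, k ≤ 4 → Integrable (fun ω => η i ω ^ k) μ)
    (h1 : ∀ i, ∫ ω, η i ω ∂μ = 0) (h2 : ∀ i, ∫ ω, η i ω ^ 2 ∂μ ≤ v i)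
    (h4 : ∀ i, ∫ ω, η i ω ^ 4 ∂μ ≤ K * v i ^ 2) (s : Finset ι) :
    (∀ k, k ≤ 4 → Integrable (fun ω => (∑ i ∈ s, η i ω) ^ k) μ) ∧
    ∫ ω, (∑ i ∈ s, η i ω) ∂μ = 0 ∧
    ∫ ω, (∑ i ∈ s, η i ω) ^ 2 ∂μ ≤ ∑ i ∈ s, v i ∧
    ∫ ω, (∑ i ∈ s, η i ω) ^ 4 ∂μ ≤ 3 * K * (∑ i ∈ s, v i) ^ 2 := by
  classical
  induction s using Finset.induction_on with
  | empty =>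
    refine ⟨fun k _ => by simp, by simp, by simp, by simp⟩
  | insert a s ha ih =>
    obtain ⟨ih0, ih1, ih2, ih4⟩ := ih
    simp_rw [Finset.sum_insert ha]
    set S : Ω → ℝ := fun ω => ∑ i ∈ s, η i ω with hS
    have hSη : IndepFun S (η a) μ := by
      have := hind.indepFun_finsetSum_of_notMem₀ hmeas ha
      convert this using 1
      ext ω
      simp [hS]
    have hpow : ∀ k l, IndepFun (fun ω => S ω ^ k) (fun ω => η a ω ^ l) μ := fun k l =>
      hSη.comp (φ := fun x => x ^ k) (ψ := fun x => x ^ l) (by fun_prop) (by fun_prop)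
    have hprod : ∀ k l, k ≤ 4 → l ≤ 4 → Integrable (fun ω => S ω ^ k * η a ω ^ l) μ :=
      fun k l hk hl => (hpow k l).integrable_mul (ih0 k hk) (hint a l hl)
    have hE : ∀ k l, k ≤ 4 → l ≤ 4 → ∫ ω, S ω ^ k * η a ω ^ l ∂μ =
        (∫ ω, S ω ^ k ∂μ) * ∫ ω, η a ω ^ l ∂μ := fun k l hk hl =>
      (hpow k l).integral_mul_eq_mul_integral (ih0 k hk).aestronglyMeasurable
        (hint a l hl).aestronglyMeasurable
    have hv : 0 ≤ v a := le_trans (integral_nonneg fun ω => sq_nonneg _) (h2 a)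
    have hT : 0 ≤ ∑ i ∈ s, v i :=
      le_trans (integral_nonneg fun ω => sq_nonneg _) ih2
    have hη1 : ∫ ω, η a ω ^ 1 ∂μ = 0 := by simpa using h1 a
    have hS1 : ∫ ω, S ω ^ 1 ∂μ = 0 := by simpa using ih1
    refine ⟨fun k hk => ?_, ?_, ?_, ?_⟩
    · simp_rw [add_comm (η a _), add_pow]
      refine integrable_finsetSum _ fun m hm => (hprod m (k - m) ?_ ?_).mul_const _
      · have := Finset.mem_range.1 hm; omega
      · omega
    · rw [integral_add (by simpa using hint a 1 (by norm_num)) (by simpa using ih0 1 (by norm_num)),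
        ih1, h1 a, add_zero]
    -- The zeroth and first powers are kept so that `hE` factors every term; those with a first
    -- power then vanish.
    · have e : ∀ ω, (η a ω + S ω) ^ 2 = S ω ^ 0 * η a ω ^ 2 + 2 * (S ω ^ 1 * η a ω ^ 1)
          + S ω ^ 2 * η a ω ^ 0 := fun ω => by ring
      have i1 := hprod 0 2 (by norm_num) (by norm_num)
      have i2 := (hprod 1 1 (by norm_num) (by norm_num)).const_mul 2
      have i3 := hprod 2 0 (by norm_num) (by norm_num)
      refine (integral_congr_ae (ae_of_all _ e)).trans_le ?_
      have j2 : Integrable (fun ω => S ω ^ 0 * η a ω ^ 2 + 2 * (S ω ^ 1 * η a ω ^ 1)) μ := i1.add i2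
      rw [integral_add j2 i3, integral_add i1 i2, integral_const_mul,
        hE 0 2 (by norm_num) (by norm_num), hE 1 1 (by norm_num) (by norm_num),
        hE 2 0 (by norm_num) (by norm_num), hη1]
      simp only [pow_zero, integral_const, probReal_univ, smul_eq_mul, one_mul, mul_one, mul_zero]
      linarith [h2 a]
    · have e : ∀ ω, (η a ω + S ω) ^ 4 = S ω ^ 0 * η a ω ^ 4 + 4 * (S ω ^ 1 * η a ω ^ 3)
          + 6 * (S ω ^ 2 * η a ω ^ 2) + 4 * (S ω ^ 3 * η a ω ^ 1) + S ω ^ 4 * η a ω ^ 0 :=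
        fun ω => by ring
      have i1 := hprod 0 4 (by norm_num) (by norm_num)
      have i2 := (hprod 1 3 (by norm_num) (by norm_num)).const_mul 4
      have i3 := (hprod 2 2 (by norm_num) (by norm_num)).const_mul 6
      have i4 := (hprod 3 1 (by norm_num) (by norm_num)).const_mul 4
      have i5 := hprod 4 0 (by norm_num) (by norm_num)
      refine (integral_congr_ae (ae_of_all _ e)).trans_le ?_
      have j2 : Integrable (fun ω => S ω ^ 0 * η a ω ^ 4 + 4 * (S ω ^ 1 * η a ω ^ 3)) μ := i1.add i2
      have j3 : Integrable (fun ω => S ω ^ 0 * η a ω ^ 4 + 4 * (S ω ^ 1 * η a ω ^ 3)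
          + 6 * (S ω ^ 2 * η a ω ^ 2)) μ := j2.add i3
      have j4 : Integrable (fun ω => S ω ^ 0 * η a ω ^ 4 + 4 * (S ω ^ 1 * η a ω ^ 3)
          + 6 * (S ω ^ 2 * η a ω ^ 2) + 4 * (S ω ^ 3 * η a ω ^ 1)) μ := j3.add i4
      rw [integral_add j4 i5, integral_add j3 i4, integral_add j2 i3, integral_add i1 i2,
        integral_const_mul, integral_const_mul, integral_const_mul,
        hE 0 4 (by norm_num) (by norm_num), hE 1 3 (by norm_num) (by norm_num),
        hE 2 2 (by norm_num) (by norm_num), hE 3 1 (by norm_num) (by norm_num),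
        hE 4 0 (by norm_num) (by norm_num), hη1, hS1]
      simp only [pow_zero, integral_const, probReal_univ, smul_eq_mul, one_mul, mul_one, mul_zero,
        zero_mul, add_zero]
      -- With `T = ∑ v i` over `s`, what is left is at most `K v² + 6 T v + 3 K T²`; as `K ≥ 1`,
      -- this is at most `3 K (T + v)²`.
      have hm : (∫ ω, S ω ^ 2 ∂μ) * ∫ ω, η a ω ^ 2 ∂μ ≤ (∑ i ∈ s, v i) * v a :=
        mul_le_mul ih2 (h2 a) (integral_nonneg fun ω => sq_nonneg _) hT
      have := h4 a
      nlinarith [mul_nonneg hT hv, mul_nonneg (mul_nonneg hT hv) (sub_nonneg.2 hK),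
        mul_nonneg (sq_nonneg (v a)) (zero_le_one.trans hK)]

theorem cfc_eq_mul {ι : Type*} [Fintype ι] [DecidableEq ι] {A : Matrix ι ι ℂ} (hA : A.IsHermitian)
    (f : ℝ → ℝ) : hA.cfc f = (hA.eigenvectorUnitary : Matrix ι ι ℂ) *
      Matrix.diagonal (fun i => (f (hA.eigenvalues i) : ℂ)) *
        (hA.eigenvectorUnitary : Matrix ι ι ℂ)ᴴ := by
  rw [Matrix.IsHermitian.cfc, Unitary.conjStarAlgAut_apply]
  rfl

theorem eq_mul_diagonal_mul {ι : Type*} [Fintype ι] [DecidableEq ι] {A : Matrix ι ι ℂ}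
    (hA : A.IsHermitian) : A = (hA.eigenvectorUnitary : Matrix ι ι ℂ) *
      Matrix.diagonal (fun i => (hA.eigenvalues i : ℂ)) *
        (hA.eigenvectorUnitary : Matrix ι ι ℂ)ᴴ := by
  conv_lhs => rw [hA.spectral_theorem, Unitary.conjStarAlgAut_apply]
  rfl

/-- Both sides are the trace of `A * A`. -/
theorem sum_sq_eigenvalues {ι : Type*} [Fintype ι] [DecidableEq ι] {A : Matrix ι ι ℂ}
    (hA : A.IsHermitian) : ∑ i, hA.eigenvalues i ^ 2 = ∑ i, ∑ j, ‖A i j‖ ^ 2 := by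
  have hU : (hA.eigenvectorUnitary : Matrix ι ι ℂ)ᴴ * (hA.eigenvectorUnitary : Matrix ι ι ℂ) = 1 :=
    Matrix.mem_unitaryGroup_iff'.1 hA.eigenvectorUnitary.2
  have h1 : (A * A).trace = ((∑ i, hA.eigenvalues i ^ 2 : ℝ) : ℂ) := by
    set U : Matrix ι ι ℂ := ↑hA.eigenvectorUnitary
    set D : Matrix ι ι ℂ := Matrix.diagonal (fun i => (hA.eigenvalues i : ℂ)) with hD
    have e : A * A = U * (D * D * Uᴴ) := by
      conv_lhs => rw [eq_mul_diagonal_mul hA]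
      calc U * D * Uᴴ * (U * D * Uᴴ) = U * D * (Uᴴ * U) * D * Uᴴ := by
            simp only [Matrix.mul_assoc]
        _ = _ := by rw [hU]; simp only [Matrix.mul_assoc, Matrix.one_mul]
    rw [e, Matrix.trace_mul_comm, Matrix.mul_assoc, hU, Matrix.mul_one, hD,
      Matrix.diagonal_mul_diagonal, Matrix.trace_diagonal]
    push_cast
    simp_rw [pow_two]
  have h2 : (A * A).trace = ((∑ i, ∑ j, ‖A i j‖ ^ 2 : ℝ) : ℂ) := by
    simp only [Matrix.trace, Matrix.diag_apply, Matrix.mul_apply]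
    push_cast
    refine Finset.sum_congr rfl fun i _ => Finset.sum_congr rfl fun j _ => ?_
    rw [← hA.apply j i, ← Complex.mul_conj', RCLike.star_def]
  exact_mod_cast h1.symm.trans h2

/-- The constant in the bound for the fourth moment of a centred Gaussian quadratic form. -/
noncomputable def quarticConst : ℝ :=
  3 * (1 + ∫ z, (‖z‖ ^ 2 - 1) ^ 4 ∂cn01) * (1 + ∫ z, (‖z‖ ^ 2 - 1) ^ 2 ∂cn01) ^ 2

theorem integrable_normSq_sub_one_pow (k : ℕ) :
    Integrable (fun z : ℂ => (‖z‖ ^ 2 - 1) ^ k) cn01 := by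
  simp_rw [sub_eq_add_neg, add_pow]
  refine integrable_finsetSum _ fun m _ => ?_
  simp_rw [← pow_mul]
  exact ((integrable_norm_pow_cn01 (2 * m)).mul_const _).mul_const _

/-- In an eigenbasis the centred form is `∑ λ_i (|Y_i|² - 1)` with `Y = X U` again i.i.d., so the
moment bound for independent sums applies. -/
theorem lintegral_quadForm_hermitian {Ω ι : Type*} [MeasurableSpace Ω] [Fintype ι]
    {μ : Measure Ω} [IsProbabilityMeasure μ] {X : ι → Ω → ℂ} (hX : IsIIDCN X μ)
    {A : Matrix ι ι ℂ} (hA : A.IsHermitian) :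
    ∫⁻ ω, ‖((X · ω) ᵥ* A) ⬝ᵥ star (X · ω) - A.trace‖ₑ ^ 4 ∂μ ≤
      ENNReal.ofReal (quarticConst * (∑ i, ∑ j, ‖A i j‖ ^ 2) ^ 2) := by
  classical
  set U : Matrix ι ι ℂ := ↑hA.eigenvectorUnitary with hU
  set l : ι → ℝ := hA.eigenvalues with hl
  set Y : ι → Ω → ℂ := fun i ω => ((X · ω) ᵥ* U) i with hY
  have hYiid : IsIIDCN Y μ := hX.vecMul_unitary hA.eigenvectorUnitary.2
  have hYm : ∀ i, AEMeasurable (Y i) μ := fun i => (hYiid.1 i).aemeasurable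
  set η : ι → Ω → ℝ := fun i ω => l i * (‖Y i ω‖ ^ 2 - 1) with hη
  have law : ∀ i k, ∫ ω, η i ω ^ k ∂μ = l i ^ k * ∫ z, (‖z‖ ^ 2 - 1) ^ k ∂cn01 := by
    intro i k
    simp_rw [hη, mul_pow]
    rw [integral_const_mul, ← (hYiid.1 i).map_eq, integral_map (hYm i) (by fun_prop)]
  have hint : ∀ i k, k ≤ 4 → Integrable (fun ω => η i ω ^ k) μ := by
    intro i k _
    simp_rw [hη, mul_pow]
    refine Integrable.const_mul ?_ _
    have := integrable_normSq_sub_one_pow k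
    rw [← (hYiid.1 i).map_eq] at this
    exact this.comp_aemeasurable (hYm i)
  have hform : ∀ ω, ((X · ω) ᵥ* A) ⬝ᵥ star (X · ω) - A.trace = ((∑ i, η i ω : ℝ) : ℂ) := by
    intro ω
    rw [hA.trace_eq_sum_eigenvalues]
    have hA' : A = U * Matrix.diagonal (fun i => (l i : ℂ)) * Uᴴ := eq_mul_diagonal_mul hA
    rw [← hl]
    conv_lhs => rw [hA']
    rw [← Matrix.vecMul_vecMul, ← Matrix.vecMul_vecMul, ← Matrix.dotProduct_mulVec,
      ← Matrix.star_vecMul]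
    simp only [hη, dotProduct, Matrix.vecMul_diagonal, Pi.star_apply, RCLike.star_def]
    push_cast
    rw [← Finset.sum_sub_distrib]
    refine Finset.sum_congr rfl fun i _ => ?_
    rw [← Complex.mul_conj']
    simp only [hY, hU, hl, Complex.coe_algebraMap]
    ring
  have hm2 : 0 ≤ ∫ z, (‖z‖ ^ 2 - 1) ^ 2 ∂cn01 := integral_nonneg fun z => sq_nonneg _
  have hm4 : 0 ≤ ∫ z, (‖z‖ ^ 2 - 1) ^ 4 ∂cn01 := integral_nonneg fun z => by positivity
  have aux : ∀ x a b : ℝ, 0 ≤ a → 0 ≤ b → x ^ 4 * b ≤ (1 + b) * ((1 + a) * x ^ 2) ^ 2 := by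
    intro x a b ha hb
    have h1 : x ^ 4 * b ≤ x ^ 4 * (1 + b) := by gcongr; linarith
    have h2 : (1 + b) * x ^ 4 * 1 ≤ (1 + b) * x ^ 4 * (1 + a) ^ 2 := by
      gcongr
      nlinarith
    nlinarith
  -- Adding 1 to both moments secures `K ≥ 1` and makes `K v_i²` dominate the fourth moment without
  -- comparing the two moments.
  obtain ⟨i4, -, -, b4⟩ := moments_sum_of_iIndepFun (η := η) (μ := μ)
    (v := fun i => (1 + ∫ z, (‖z‖ ^ 2 - 1) ^ 2 ∂cn01) * l i ^ 2)
    (K := 1 + ∫ z, (‖z‖ ^ 2 - 1) ^ 4 ∂cn01) (by linarith)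
    (fun i => by simp only [hη]; have := hYm i; fun_prop)
    (hYiid.2.comp (fun i z => l i * (‖z‖ ^ 2 - 1)) (fun i => by fun_prop)) hint
    (fun i => by
      have := law i 1
      simp only [pow_one] at this
      rw [this, integral_sub (integrable_norm_pow_cn01 2) (integrable_const _),
        integral_normSq_cn01]
      simp)
    (fun i => by
      rw [law i 2]
      nlinarith [sq_nonneg (l i)])
    (fun i => by
      rw [law i 4]
      exact aux _ _ _ hm2 hm4) Finset.univ
  have e : ∀ ω, ‖((X · ω) ᵥ* A) ⬝ᵥ star (X · ω) - A.trace‖ₑ ^ 4 =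
      ENNReal.ofReal ((∑ i, η i ω) ^ 4) := by
    intro ω
    rw [hform, ← ofReal_norm, ← ENNReal.ofReal_pow (norm_nonneg _), Complex.norm_real,
      Real.norm_eq_abs, Even.pow_abs (by decide)]
  simp_rw [e]
  rw [← ofReal_integral_eq_lintegral_ofReal (i4 4 le_rfl) (ae_of_all _ fun ω => by positivity)]
  refine ENNReal.ofReal_le_ofReal (b4.trans_eq ?_)
  rw [← Finset.mul_sum, hl, sum_sq_eigenvalues, quarticConst]
  ring

/-- The fourth moments of `f n / n` are O(n⁻²), so `∑ ‖f n / n‖⁴` has finite expectation and is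
almost surely finite. Linearity of expectation suffices, hence no joint law is involved; second
moments of order `1/n` would not be summable. -/
theorem tendsto_div_of_lintegral_pow_four {Ω : Type*} [MeasurableSpace Ω] {μ : Measure Ω}
    {f : ℕ → Ω → ℂ} (hf : ∀ n, AEMeasurable (f n) μ) {K : ℝ}
    (hK : ∀ n, ∫⁻ ω, ‖f n ω‖ₑ ^ 4 ∂μ ≤ ENNReal.ofReal (K * (n : ℝ) ^ 2)) :
    ∀ᵐ ω ∂μ, Tendsto (fun n : ℕ => f n ω / n) atTop (𝓝 0) := by
  have hK0 : ∀ n, ∫⁻ ω, ‖f n ω‖ₑ ^ 4 ∂μ ≤ ENNReal.ofReal (|K| * (n : ℝ) ^ 2) := fun n =>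
    (hK n).trans (ENNReal.ofReal_le_ofReal (by gcongr; exact le_abs_self K))
  have e : ∀ n : ℕ, ∀ ω, ‖f n ω / n‖ₑ ^ 4 = ‖f n ω‖ₑ ^ 4 * ENNReal.ofReal (((n : ℝ) ^ 4)⁻¹) := by
    intro n ω
    rw [div_eq_mul_inv, enorm_mul, mul_pow]
    congr 1
    rw [← ofReal_norm, ← ENNReal.ofReal_pow (norm_nonneg _)]
    simp
  have hb : ∀ n : ℕ, ∫⁻ ω, ‖f n ω / n‖ₑ ^ 4 ∂μ ≤ ENNReal.ofReal (|K| * ((n : ℝ) ^ 2)⁻¹) := by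
    intro n
    simp_rw [e]
    rw [lintegral_mul_const'' _ ((hf n).enorm.pow_const 4)]
    calc _ ≤ ENNReal.ofReal (|K| * (n : ℝ) ^ 2) * ENNReal.ofReal (((n : ℝ) ^ 4)⁻¹) := by
          gcongr
          exact hK0 n
      _ = ENNReal.ofReal (|K| * ((n : ℝ) ^ 2)⁻¹) := by
        rw [← ENNReal.ofReal_mul (by positivity)]
        congr 1
        rcases Nat.eq_zero_or_pos n with rfl | hn
        · simp
        · field_simp
  have hsum : ∑' n : ℕ, ∫⁻ ω, ‖f n ω / n‖ₑ ^ 4 ∂μ ≠ ⊤ := by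
    refine ne_top_of_le_ne_top ?_ (ENNReal.tsum_le_tsum hb)
    refine Summable.tsum_ofReal_ne_top ?_
    exact (Real.summable_nat_pow_inv.2 (by norm_num)).mul_left _
  rw [← lintegral_tsum fun n => ((hf n).div_const _).enorm.pow_const 4] at hsum
  have hae := ae_lt_top' (AEMeasurable.tsum fun n =>
    ((hf n).div_const _).enorm.pow_const 4) hsum
  filter_upwards [hae] with ω hω
  have h0 := ENNReal.tendsto_atTop_zero_of_tsum_ne_top hω.ne
  rw [tendsto_zero_iff_norm_tendsto_zero]
  have h1 := (ENNReal.tendsto_toReal (by simp)).comp h0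
  simp only [Function.comp_def, ENNReal.toReal_pow, toReal_enorm, ENNReal.toReal_zero] at h1
  have h2 := h1.sqrt.sqrt
  simp only [Real.sqrt_zero] at h2
  refine h2.congr fun n => ?_
  rw [show ‖f n ω / (n : ℂ)‖ ^ 4 = (‖f n ω / (n : ℂ)‖ ^ 2) ^ 2 by ring,
    Real.sqrt_sq (by positivity), Real.sqrt_sq (by positivity)]

theorem aemeasurable_sesqForm {Ω ι κ : Type*} [MeasurableSpace Ω] [Fintype ι] [Fintype κ]
    {μ : Measure Ω} {X : ι → Ω → ℂ} {Y : κ → Ω → ℂ} (hX : ∀ i, AEMeasurable (X i) μ)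
    (hY : ∀ i, AEMeasurable (Y i) μ) (A : Matrix ι κ ℂ) :
    AEMeasurable (fun ω => ((X · ω) ᵥ* A) ⬝ᵥ star (Y · ω)) μ := by
  simp only [Matrix.vecMul, dotProduct, Pi.star_apply]
  refine Finset.aemeasurable_fun_sum _ fun j _ => AEMeasurable.mul ?_ ?_
  · exact Finset.aemeasurable_fun_sum _ fun i _ => (hX i).mul_const _
  · exact (continuous_star.measurable).comp_aemeasurable (hY j)

/-- Gaussian quadratic forms concentrate at their means, almost surely, with no assumption on the
joint law for different sizes. -/
theorem tendsto_quadForm {Ω : Type*} [MeasurableSpace Ω] {μ : Measure Ω} [IsProbabilityMeasure μ]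
    {ι : ℕ → Type*} [∀ n, Fintype (ι n)] {X : ∀ n, ι n → Ω → ℂ} (hX : ∀ n, IsIIDCN (X n) μ)
    (A : ∀ n, Matrix (ι n) (ι n) ℂ) {K : ℝ} (hK : ∀ n, ∑ i, ∑ j, ‖A n i j‖ ^ 2 ≤ K * n) :
    ∀ᵐ ω ∂μ, Tendsto (fun n : ℕ => (((X n · ω) ᵥ* A n) ⬝ᵥ star (X n · ω) - (A n).trace) / n)
      atTop (𝓝 0) := by
  have herm : ∀ B : ∀ n, Matrix (ι n) (ι n) ℂ, (∀ n, (B n).IsHermitian) →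
      (∀ n, ∑ i, ∑ j, ‖B n i j‖ ^ 2 ≤ K * n) → ∀ᵐ ω ∂μ, Tendsto (fun n : ℕ =>
        (((X n · ω) ᵥ* B n) ⬝ᵥ star (X n · ω) - (B n).trace) / n) atTop (𝓝 0) := by
    intro B hB hBK
    have hm : ∀ n i, AEMeasurable (X n i) μ := fun n i => ((hX n).1 i).aemeasurable
    refine tendsto_div_of_lintegral_pow_four (K := quarticConst * K ^ 2)
      (fun n => (aemeasurable_sesqForm (hm n) (hm n) _).sub_const _) fun n => ?_
    refine (lintegral_quadForm_hermitian (hX n) (hB n)).trans (ENNReal.ofReal_le_ofReal ?_)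
    rw [mul_assoc, ← mul_pow]
    have hq : 0 ≤ quarticConst := by
      have hm4 : 0 ≤ ∫ z, (‖z‖ ^ 2 - 1) ^ 4 ∂cn01 := integral_nonneg fun z => by positivity
      unfold quarticConst
      positivity
    gcongr
    exact hBK n
  have hsq : ∀ x y : ℂ, ‖(1 / 2 : ℂ) * (x + y)‖ ^ 2 ≤ (1 / 2) * (‖x‖ ^ 2 + ‖y‖ ^ 2) := by
    intro x y
    have h := norm_add_le x y
    rw [norm_mul, mul_pow]
    norm_num
    nlinarith [sq_nonneg (‖x‖ - ‖y‖), norm_nonneg (x + y), norm_nonneg x, norm_nonneg y]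
  -- The values `x = 1` and `x = -I` give the Hermitian parts `(A + Aᴴ)/2` and `(A - Aᴴ)/(2i)`;
  -- neither exceeds `A` in Frobenius norm, and `A` is the first plus `I` times the second.
  have hsum : ∀ (x : ℂ) n, ‖x‖ = 1 →
      ∑ i, ∑ j, ‖((1 / 2 : ℂ) • (x • A n + star x • (A n)ᴴ)) i j‖ ^ 2 ≤ K * n := by
    intro x n hx
    refine le_trans ?_ (hK n)
    calc _ ≤ ∑ i, ∑ j, (1 / 2) * (‖A n i j‖ ^ 2 + ‖A n j i‖ ^ 2) := by
          refine Finset.sum_le_sum fun i _ => Finset.sum_le_sum fun j _ => ?_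
          refine (hsq _ _).trans_eq ?_
          simp [hx]
      _ = ∑ i, ∑ j, ‖A n i j‖ ^ 2 := by
          simp_rw [mul_add, Finset.sum_add_distrib]
          rw [Finset.sum_comm (f := fun i j => (1 / 2 : ℝ) * ‖A n j i‖ ^ 2)]
          simp_rw [← Finset.mul_sum]
          ring
  have hH : ∀ (x : ℂ) n, ((1 / 2 : ℂ) • (x • A n + star x • (A n)ᴴ)).IsHermitian := by
    intro x n
    ext i j
    simp
    ring
  filter_upwards [herm _ (hH 1) fun n => hsum 1 n (by simp),
    herm _ (hH (-Complex.I)) fun n => hsum (-Complex.I) n (by simp)] with ω h1 h2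
  have h3 := h1.add (h2.const_mul Complex.I)
  rw [mul_zero, add_zero] at h3
  refine h3.congr fun n => ?_
  simp only [Matrix.vecMul_smul, Matrix.vecMul_add, smul_dotProduct, add_dotProduct,
    Matrix.trace_smul, Matrix.trace_add, smul_eq_mul, star_one, star_neg, RCLike.star_def,
    Complex.conj_I, neg_neg]
  ring_nf
  simp only [Complex.I_sq]
  ring

/-! ### Operator norm estimates. -/

section operatorNorm

open scoped Matrix.Norms.L2Operator

variable {m n p q ι : Type*} [Fintype m] [Fintype n] [Fintype p] [Fintype q] [Fintype ι]
  [DecidableEq n] [DecidableEq q] [DecidableEq ι]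

theorem norm_cfc_le {A : Matrix ι ι ℂ} (hA : A.IsHermitian) {f : ℝ → ℝ} {K : ℝ} (hK : 0 ≤ K)
    (hf : ∀ i, |f (hA.eigenvalues i)| ≤ K) : ‖hA.cfc f‖ ≤ K := by
  rw [Matrix.IsHermitian.cfc, Unitary.conjStarAlgAut_apply, ← Unitary.coe_star,
    CStarRing.norm_mul_coe_unitary,
    CStarRing.norm_coe_unitary_mul, Matrix.l2_opNorm_diagonal]
  exact (pi_norm_le_iff_of_nonneg hK).2 fun i => by simpa using hf i

theorem sum_normSq_mulVec_le (M : Matrix m n ℂ) (x : n → ℂ) :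
    ∑ i, ‖(M *ᵥ x) i‖ ^ 2 ≤ ‖M‖ ^ 2 * ∑ j, ‖x j‖ ^ 2 := by
  have h := M.l2_opNorm_mulVec (WithLp.toLp 2 x)
  have h2 := pow_le_pow_left₀ (norm_nonneg _) h 2
  rw [mul_pow, EuclideanSpace.norm_sq_eq, EuclideanSpace.norm_sq_eq] at h2
  exact h2

theorem opNorm_le_of_sum_normSq {M : Matrix m n ℂ} {K : ℝ} (hK : 0 ≤ K)
    (h : ∀ x : n → ℂ, ∑ i, ‖(M *ᵥ x) i‖ ^ 2 ≤ K ^ 2 * ∑ j, ‖x j‖ ^ 2) : ‖M‖ ≤ K := by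
  rw [Matrix.l2_opNorm_def]
  refine ContinuousLinearMap.opNorm_le_bound _ hK fun x => ?_
  refine le_of_sq_le_sq ?_ (by positivity)
  rw [mul_pow, EuclideanSpace.norm_sq_eq, EuclideanSpace.norm_sq_eq]
  exact h x.ofLp

/-- The product acts by `B` on the second index and then by `A` on the first, each slice by slice.
-/
theorem norm_kronecker_le (A : Matrix m n ℂ) (B : Matrix p q ℂ) : ‖A ⊗ₖ B‖ ≤ ‖A‖ * ‖B‖ := by
  refine opNorm_le_of_sum_normSq (by positivity) fun x => ?_
  have e : ∀ i k, ((A ⊗ₖ B) *ᵥ x) (i, k) = (A *ᵥ fun j => (B *ᵥ fun l => x (j, l)) k) i := by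
    intro i k
    simp only [Matrix.mulVec, dotProduct, Matrix.kroneckerMap_apply, Fintype.sum_prod_type,
      Finset.mul_sum, mul_assoc]
  rw [Fintype.sum_prod_type, Finset.sum_comm, Fintype.sum_prod_type]
  calc _ ≤ ∑ k, ‖A‖ ^ 2 * ∑ j, ‖(B *ᵥ fun l => x (j, l)) k‖ ^ 2 := by
        refine Finset.sum_le_sum fun k _ => ?_
        simp_rw [e]
        exact sum_normSq_mulVec_le A _
    _ = ‖A‖ ^ 2 * ∑ j, ∑ k, ‖(B *ᵥ fun l => x (j, l)) k‖ ^ 2 := by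
        rw [← Finset.mul_sum, Finset.sum_comm]
    _ ≤ ‖A‖ ^ 2 * ∑ j, ‖B‖ ^ 2 * ∑ l, ‖x (j, l)‖ ^ 2 := by
        gcongr with j
        exact sum_normSq_mulVec_le B _
    _ = _ := by rw [← Finset.mul_sum]; ring

/-- Each column is the image of a unit vector. This turns uniform operator bounds into Frobenius
bounds linear in the size. -/
theorem sum_normSq_le_card_mul (M : Matrix m n ℂ) :
    ∑ i, ∑ j, ‖M i j‖ ^ 2 ≤ Fintype.card n * ‖M‖ ^ 2 := by
  rw [Finset.sum_comm]
  calc _ ≤ ∑ _j : n, ‖M‖ ^ 2 := by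
        refine Finset.sum_le_sum fun j _ => ?_
        have h := sum_normSq_mulVec_le M (Pi.single j 1)
        have e : ∑ k, ‖(Pi.single j 1 : n → ℂ) k‖ ^ 2 = 1 := by
          rw [Finset.sum_eq_single j (fun k _ hk => by simp [hk]) (by simp)]
          simp
        simpa [e] using h
    _ = _ := by simp

theorem norm_apply_le_opNorm (M : Matrix m n ℂ) (i : m) (j : n) : ‖M i j‖ ≤ ‖M‖ := by
  have h := sum_normSq_mulVec_le M (Pi.single j 1)
  have e : ∑ k, ‖(Pi.single j 1 : n → ℂ) k‖ ^ 2 = 1 := by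
    rw [Finset.sum_eq_single j (fun k _ hk => by simp [hk]) (by simp)]
    simp
  rw [e, mul_one] at h
  refine le_of_sq_le_sq (le_trans ?_ h) (norm_nonneg _)
  refine (Finset.single_le_sum (f := fun i => ‖(M *ᵥ Pi.single j 1) i‖ ^ 2)
    (fun _ _ => by positivity) (Finset.mem_univ i)).trans' ?_
  simp

theorem norm_trace_le_card_mul (M : Matrix ι ι ℂ) : ‖M.trace‖ ≤ Fintype.card ι * ‖M‖ := by
  refine (norm_sum_le _ _).trans ?_
  calc _ ≤ ∑ _i : ι, ‖M‖ := Finset.sum_le_sum fun i _ => norm_apply_le_opNorm M i i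
    _ = _ := by simp

/-- These matrices are isometries; multiplying a row by one extracts the block indexed by `e`, which
is how several independent vectors become parts of a single one. -/
theorem norm_one_submatrix_le {e : n → ι} (he : Function.Injective e) :
    ‖(1 : Matrix ι ι ℂ).submatrix id e‖ ≤ 1 := by
  refine opNorm_le_of_sum_normSq zero_le_one fun x => ?_
  have h : ∀ w : ι → ℂ, ((∑ i, ‖w i‖ ^ 2 : ℝ) : ℂ) = star w ⬝ᵥ w := by
    intro w
    simp [dotProduct, ← Complex.conj_mul']
  have h' : ((∑ i, ‖x i‖ ^ 2 : ℝ) : ℂ) = star x ⬝ᵥ x := by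
    simp [dotProduct, ← Complex.conj_mul']
  have hE : ((1 : Matrix ι ι ℂ).submatrix id e)ᴴ * (1 : Matrix ι ι ℂ).submatrix id e = 1 := by
    rw [Matrix.conjTranspose_submatrix, Matrix.conjTranspose_one,
      ← Matrix.submatrix_mul _ _ _ _ _ Function.bijective_id, Matrix.one_mul,
      Matrix.submatrix_one _ he]
  rw [one_pow, one_mul]
  have := h ((1 : Matrix ι ι ℂ).submatrix id e *ᵥ x)
  rw [Matrix.star_mulVec, ← Matrix.dotProduct_mulVec, Matrix.mulVec_mulVec, hE,
    Matrix.one_mulVec, ← h'] at this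
  exact (Complex.ofReal_injective this).le

end operatorNorm

theorem vecMul_one_submatrix {n ι : Type*} [Fintype ι] [DecidableEq ι] (e : n → ι) (v : ι → ℂ) :
    v ᵥ* (1 : Matrix ι ι ℂ).submatrix id e = fun k => v (e k) := by
  ext k
  simp [Matrix.vecMul, dotProduct, Matrix.one_apply]

/-! ### Functions of Hermitian matrices: square root, truncated inverse, pseudoinverse. -/

section hermitian

variable {n : ℕ} {A : Matrix (Fin n) (Fin n) ℂ}

theorem cfc_mul_cfc (hA : A.IsHermitian) (f g : ℝ → ℝ) :
    hA.cfc f * hA.cfc g = hA.cfc fun x => f x * g x := by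
  have hU : (hA.eigenvectorUnitary : Matrix (Fin n) (Fin n) ℂ)ᴴ *
      (hA.eigenvectorUnitary : Matrix (Fin n) (Fin n) ℂ) = 1 :=
    Matrix.mem_unitaryGroup_iff'.1 hA.eigenvectorUnitary.2
  simp only [cfc_eq_mul]
  calc _ = (hA.eigenvectorUnitary : Matrix (Fin n) (Fin n) ℂ) *
        (Matrix.diagonal (fun i => (f (hA.eigenvalues i) : ℂ)) *
          ((hA.eigenvectorUnitary : Matrix (Fin n) (Fin n) ℂ)ᴴ *
            (hA.eigenvectorUnitary : Matrix (Fin n) (Fin n) ℂ)) *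
          Matrix.diagonal (fun i => (g (hA.eigenvalues i) : ℂ))) *
        (hA.eigenvectorUnitary : Matrix (Fin n) (Fin n) ℂ)ᴴ := by
        simp only [Matrix.mul_assoc]
    _ = _ := by
        rw [hU, Matrix.mul_one, Matrix.diagonal_mul_diagonal]
        push_cast
        rfl

theorem cfc_congr_eigenvalues (hA : A.IsHermitian) {f g : ℝ → ℝ}
    (h : ∀ i, f (hA.eigenvalues i) = g (hA.eigenvalues i)) : hA.cfc f = hA.cfc g := by
  simp only [cfc_eq_mul, h]

theorem cfc_id_eq (hA : A.IsHermitian) : hA.cfc (fun x => x) = A := by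
  rw [cfc_eq_mul, ← eq_mul_diagonal_mul]

theorem trace_cfc (hA : A.IsHermitian) (f : ℝ → ℝ) :
    (hA.cfc f).trace = ∑ i, (f (hA.eigenvalues i) : ℂ) := by
  have hU : (hA.eigenvectorUnitary : Matrix (Fin n) (Fin n) ℂ)ᴴ *
      (hA.eigenvectorUnitary : Matrix (Fin n) (Fin n) ℂ) = 1 :=
    Matrix.mem_unitaryGroup_iff'.1 hA.eigenvectorUnitary.2
  rw [cfc_eq_mul, Matrix.mul_assoc, Matrix.trace_mul_comm, Matrix.mul_assoc, hU, Matrix.mul_one,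
    Matrix.trace_diagonal]

theorem conjTranspose_cfc (hA : A.IsHermitian) (f : ℝ → ℝ) : (hA.cfc f)ᴴ = hA.cfc f := by
  simp only [cfc_eq_mul, Matrix.conjTranspose_mul, Matrix.conjTranspose_conjTranspose,
    Matrix.diagonal_conjTranspose, Matrix.mul_assoc]
  congr 3
  ext i
  simp

theorem hermSqrt_mul_self (hA : A.IsHermitian) (h : ∀ i, 0 ≤ hA.eigenvalues i) :
    hermSqrt hA * hermSqrt hA = A := by
  conv_rhs => rw [← cfc_id_eq hA]
  rw [hermSqrt, cfc_mul_cfc]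
  exact cfc_congr_eigenvalues hA fun i => Real.mul_self_sqrt (h i)

/-- Each significant eigenvalue contributes `√λ · λ⁻¹ · √λ = 1`, the others 0. -/
theorem trace_hermSqrt_truncInv (hA : A.IsHermitian) {τ : ℝ} (hτ : 0 < τ) :
    (hermSqrt hA * truncInv hA τ * (hermSqrt hA)ᴴ).trace = effRank hA τ := by
  rw [hermSqrt, conjTranspose_cfc, truncInv, cfc_mul_cfc, cfc_mul_cfc, trace_cfc, effRank,
    Finset.card_filter]
  push_cast
  refine Finset.sum_congr rfl fun i _ => ?_
  split_ifs with h
  · have h0 := hτ.trans_le h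
    have : √(hA.eigenvalues i) * (hA.eigenvalues i)⁻¹ * √(hA.eigenvalues i) = 1 := by
      rw [mul_right_comm, Real.mul_self_sqrt h0.le, mul_inv_cancel₀ h0.ne']
    exact_mod_cast this
  · simp

theorem trace_hermSqrt_mul_mul (hA : A.IsHermitian) (h : ∀ i, 0 ≤ hA.eigenvalues i)
    (Q : Matrix (Fin n) (Fin n) ℂ) :
    (hermSqrt hA * Q * (hermSqrt hA)ᴴ).trace = (A * Q).trace := by
  rw [Matrix.trace_mul_comm, ← Matrix.mul_assoc, hermSqrt, conjTranspose_cfc, ← hermSqrt,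
    hermSqrt_mul_self hA h]

open scoped Matrix.Norms.L2Operator in
theorem norm_hermSqrt_le (hA : A.IsHermitian) {K : ℝ} (hK : ∀ i, hA.eigenvalues i ≤ K) :
    ‖hermSqrt hA‖ ≤ √K :=
  norm_cfc_le hA (Real.sqrt_nonneg _) fun i => by
    rw [abs_of_nonneg (Real.sqrt_nonneg _)]
    exact Real.sqrt_le_sqrt (hK i)

open scoped Matrix.Norms.L2Operator in
theorem norm_truncInv_le (hA : A.IsHermitian) {τ c : ℝ} (hc : 0 < c) (hτ : c ≤ τ) :
    ‖truncInv hA τ‖ ≤ c⁻¹ :=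
  norm_cfc_le hA (by positivity) fun i => by
    split_ifs with h
    · have h0 := hc.trans_le (hτ.trans h)
      rw [abs_of_pos (inv_pos.2 h0)]
      exact inv_anti₀ hc (hτ.trans h)
    · simpa using hc.le

theorem mul_pseudoInv_mul (hA : A.IsHermitian) : A * pseudoInv hA * A = A := by
  have h : hA.cfc (fun x => x) * pseudoInv hA * hA.cfc (fun x => x) = hA.cfc (fun x => x) := by
    rw [pseudoInv, cfc_mul_cfc, cfc_mul_cfc]
    exact cfc_congr_eigenvalues hA fun i => mul_inv_mul_cancel _
  rwa [cfc_id_eq] at h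

end hermitian

/-! ### The frequency factor: full rank of the DFT rows. -/

/-- The first `L` subcarriers already give a square Vandermonde system, whose nodes are distinct
`N`-th roots of unity. -/
theorem eq_zero_of_vecMul_dftRows_eq_zero {N L s : ℕ} (hs : L ≤ s) {p : Fin s → Fin N}
    (hp : Function.Injective p) {v : Fin L → ℂ} (hv : v ᵥ* (dftRows N L p)ᵀ = 0) : v = 0 := by
  set z : Fin s → ℂ := fun k => Complex.exp (2 * Real.pi * Complex.I / N) ^ (p k : ℕ) with hz
  have hzinj : Function.Injective z := by
    intro k k' h
    have hN : N ≠ 0 := by have := (p k).2; omega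
    exact hp (Fin.ext ((Complex.isPrimitiveRoot_exp N hN).pow_inj (p k).2 (p k').2 h))
  have hinj : Function.Injective (fun i : Fin L => (z (Fin.castLE hs i))⁻¹) := fun i j h =>
    Fin.castLE_injective hs (hzinj (inv_injective h))
  refine Matrix.eq_zero_of_forall_index_sum_mul_pow_eq_zero hinj fun j => ?_
  have h := congrFun hv (Fin.castLE hs j)
  simp only [Matrix.vecMul, dotProduct, Matrix.transpose_apply, dftRows, Matrix.of_apply,
    Pi.zero_apply] at h
  rw [← h]
  refine Finset.sum_congr rfl fun l _ => ?_
  congr 1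
  simp only [hz]
  rw [← Complex.exp_nat_mul, ← Complex.exp_neg, ← Complex.exp_nat_mul]
  congr 1
  ring

/-- The Moore–Penrose identity for `Mᴴ M` reads `Mᴴ (P - 1) M = 0`. Full rank lets `M` be cancelled
on the right, and after a conjugate transpose also `Mᴴ` on the left. -/
theorem dftRows_mul_pseudoInv_mul {N L s : ℕ} (hs : L ≤ s) {p : Fin s → Fin N}
    (hp : Function.Injective p) :
    (dftRows N L p)ᵀ * pseudoInv (freqCov_isHermitian (dftRows N L p)) * ((dftRows N L p)ᵀ)ᴴ
      = 1 := by
  set M := (dftRows N L p)ᵀ with hM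
  have cancel : ∀ {k : ℕ} (B : Matrix (Fin k) (Fin L) ℂ), B * M = 0 → B = 0 := by
    intro k B hB
    ext i j
    have : B i = 0 := eq_zero_of_vecMul_dftRows_eq_zero hs hp (by
      rw [← hM]
      ext l
      exact congrFun (congrFun hB i) l)
    exact congrFun this j
  set P := M * pseudoInv (freqCov_isHermitian (dftRows N L p)) * Mᴴ with hP
  have h1 : (Mᴴ * (P - 1)) * M = 0 := by
    have : Mᴴ * M * pseudoInv (freqCov_isHermitian (dftRows N L p)) * (Mᴴ * M) = Mᴴ * M :=
      mul_pseudoInv_mul (freqCov_isHermitian (dftRows N L p))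
    rw [Matrix.mul_sub, Matrix.sub_mul, Matrix.mul_one, hP, sub_eq_zero]
    refine Eq.trans ?_ this
    simp only [Matrix.mul_assoc]
  have h2 := cancel _ h1
  have h3 : (P - 1)ᴴ * M = 0 := by
    have := congrArg Matrix.conjTranspose h2
    rwa [Matrix.conjTranspose_mul, Matrix.conjTranspose_conjTranspose,
      Matrix.conjTranspose_zero] at this
  have h4 := congrArg Matrix.conjTranspose (cancel _ h3)
  rw [Matrix.conjTranspose_conjTranspose, Matrix.conjTranspose_zero] at h4
  exact sub_eq_zero.1 h4

theorem trace_dftRows_mul_conjTranspose {N L s : ℕ} (p : Fin s → Fin N) :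
    ((dftRows N L p)ᵀ * ((dftRows N L p)ᵀ)ᴴ).trace = (s : ℂ) * L := by
  have h : ∀ k l, dftRows N L p k l * star (dftRows N L p k l) = 1 := by
    intro k l
    rw [RCLike.star_def, Complex.mul_conj', dftRows, Matrix.of_apply]
    have : -Complex.I * 2 * Real.pi * (p k : ℕ) * (l : ℕ) / N =
        ((-2 * Real.pi * (p k : ℕ) * (l : ℕ) / N : ℝ) : ℂ) * Complex.I := by
      push_cast
      ring
    rw [this, Complex.norm_exp_ofReal_mul_I]
    simp
  simp only [Matrix.trace, Matrix.diag_apply, Matrix.mul_apply, Matrix.conjTranspose_apply,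
    Matrix.transpose_apply, h]
  simp
  ring

theorem trace_freqCov_dftRows {N L s : ℕ} (p : Fin s → Fin N) :
    (freqCov (dftRows N L p)).trace = (s : ℂ) * L := by
  rw [freqCov, Matrix.trace_mul_comm, trace_dftRows_mul_conjTranspose]

/-! ### The one-ring covariance: trace and uniform spectral bound. -/

theorem trace_ringCov {D Δ : ℝ} (hΔ : 0 < Δ) (L : ℕ) (θ : ℝ) (n : ℕ) :
    (ringCov D Δ L θ n).trace = (n : ℂ) / L := by
  have hΔ' : (Δ : ℂ) ≠ 0 := by exact_mod_cast hΔ.ne'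
  have h : ∀ a, ringCov D Δ L θ n a a = 1 / L := by
    intro a
    simp only [ringCov, Matrix.of_apply, sub_self, mul_zero, zero_mul, Complex.exp_zero,
      intervalIntegral.integral_const]
    have : θ + Δ - (θ - Δ) = 2 * Δ := by ring
    rw [this, Complex.real_smul]
    push_cast
    field_simp
  simp only [Matrix.trace, Matrix.diag_apply, h]
  simp
  ring

section ring

/-- The trigonometric polynomial `∑ w_a e^{-2πiau}`. -/
noncomputable def trigPoly {n : ℕ} (w : Fin n → ℂ) (u : ℝ) : ℂ :=
  ∑ a, w a * Complex.exp (-Complex.I * 2 * Real.pi * (a : ℕ) * u)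

theorem continuous_trigPoly {n : ℕ} (w : Fin n → ℂ) : Continuous (trigPoly w) := by
  unfold trigPoly
  fun_prop

theorem normSq_trigPoly {n : ℕ} (w : Fin n → ℂ) (u : ℝ) : ((‖trigPoly w u‖ ^ 2 : ℝ) : ℂ) =
    ∑ a, ∑ b, w a * star (w b) *
      Complex.exp (-Complex.I * 2 * Real.pi * ((a : ℕ) - (b : ℕ) : ℂ) * u) := by
  push_cast
  rw [← Complex.mul_conj', trigPoly, map_sum, Finset.sum_mul_sum]
  refine Finset.sum_congr rfl fun a _ => Finset.sum_congr rfl fun b _ => ?_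
  rw [map_mul, ← Complex.exp_conj, mul_mul_mul_comm, ← Complex.exp_add, RCLike.star_def]
  congr 2
  simp only [map_mul, map_neg, Complex.conj_I, Complex.conj_ofReal, map_natCast, map_ofNat]
  ring

/-- Parseval over `2 m` full periods. -/
theorem integral_normSq_trigPoly {n : ℕ} (w : Fin n → ℂ) (m : ℕ) :
    ∫ u in (-m : ℝ)..m, ‖trigPoly w u‖ ^ 2 = 2 * m * ∑ a, ‖w a‖ ^ 2 := by
  have hker : ∀ a b : Fin n, ∫ u in (-m : ℝ)..m,
      Complex.exp (-Complex.I * 2 * Real.pi * ((a : ℕ) - (b : ℕ) : ℂ) * u) =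
        if a = b then (2 * m : ℂ) else 0 := by
    intro a b
    split_ifs with hab
    · subst hab
      simp
      ring
    · have hne : ((a : ℕ) - (b : ℕ) : ℂ) ≠ 0 := by
        rw [sub_ne_zero]
        exact_mod_cast fun h => hab (Fin.ext h)
      have hc : (-Complex.I * 2 * Real.pi * ((a : ℕ) - (b : ℕ) : ℂ)) ≠ 0 := by
        simp [Real.pi_ne_zero, hne]
      rw [integral_exp_mul_complex hc, div_eq_zero_iff]
      left
      rw [sub_eq_zero, Complex.exp_eq_exp_iff_exists_int]
      refine ⟨-(2 * ((a : ℕ) - (b : ℕ)) * m), ?_⟩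
      push_cast
      ring
  have h : ((∫ u in (-m : ℝ)..m, ‖trigPoly w u‖ ^ 2 : ℝ) : ℂ) =
      ((2 * m * ∑ a, ‖w a‖ ^ 2 : ℝ) : ℂ) := by
    rw [← intervalIntegral.integral_ofReal]
    simp_rw [normSq_trigPoly]
    rw [intervalIntegral.integral_finsetSum fun a _ => Continuous.intervalIntegrable
      (by fun_prop) _ _]
    push_cast
    rw [Finset.mul_sum]
    refine Finset.sum_congr rfl fun a _ => ?_
    rw [intervalIntegral.integral_finsetSum fun b _ => Continuous.intervalIntegrable
      (by fun_prop) _ _]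
    simp_rw [intervalIntegral.integral_const_mul, hker]
    rw [Finset.sum_eq_single a (fun b _ hb => by simp [hb.symm]) (by simp)]
    rw [if_pos rfl, RCLike.star_def, Complex.mul_conj']
    ring
  exact_mod_cast h

variable {D Δ θ : ℝ}

/-- Writing the quadratic form as an integral of a square shows positivity and reduces the spectral
bound to Parseval. -/
theorem star_dotProduct_ringCov_mulVec (L n : ℕ) (v : Fin n → ℂ) :
    star v ⬝ᵥ (ringCov D Δ L θ n *ᵥ v) = ((1 / (2 * Δ * L) *
      ∫ t in (θ - Δ)..(θ + Δ), ‖trigPoly (star v) (D * Real.sin t)‖ ^ 2 : ℝ) : ℂ) := by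
  push_cast
  rw [← intervalIntegral.integral_ofReal]
  simp_rw [normSq_trigPoly]
  rw [intervalIntegral.integral_finsetSum fun a _ => Continuous.intervalIntegrable
      (by fun_prop) _ _, Finset.mul_sum, dotProduct]
  refine Finset.sum_congr rfl fun a _ => ?_
  rw [intervalIntegral.integral_finsetSum fun b _ => Continuous.intervalIntegrable
      (by fun_prop) _ _, Finset.mul_sum, Matrix.mulVec, dotProduct, Finset.mul_sum]
  refine Finset.sum_congr rfl fun b _ => ?_
  rw [intervalIntegral.integral_const_mul, ringCov, Matrix.of_apply]
  simp only [Pi.star_apply, star_star]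
  rw [mul_left_comm, mul_assoc (1 / (2 * (Δ : ℂ) * L)),
    mul_comm _ (star (v a) * v b)]
  congr 3
  ext t
  congr 1
  push_cast
  ring

/-- Substitute `u = D sin t`: since `cos t ≥ 1/2`, the Jacobian costs at most `2 / D`. The range of
`u` lies in `[-⌈D⌉, ⌈D⌉]`, a whole number `2⌈D⌉` of periods, so Parseval is exact there. -/
theorem integral_normSq_trigPoly_sin_le (hD : 0 < D) (hΔ : 0 < Δ)
    (hθ : -(Real.pi / 3) ≤ θ - Δ ∧ θ + Δ ≤ Real.pi / 3) {n : ℕ} (w : Fin n → ℂ) :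
    ∫ t in (θ - Δ)..(θ + Δ), ‖trigPoly w (D * Real.sin t)‖ ^ 2 ≤
      4 * ⌈D⌉₊ / D * ∑ a, ‖w a‖ ^ 2 := by
  have hcont := continuous_trigPoly w
  have hle : θ - Δ ≤ θ + Δ := by linarith
  have hpi := Real.pi_pos
  have hceil : D ≤ ⌈D⌉₊ := Nat.le_ceil D
  calc ∫ t in (θ - Δ)..(θ + Δ), ‖trigPoly w (D * Real.sin t)‖ ^ 2
      ≤ ∫ t in (θ - Δ)..(θ + Δ), 2 / D *
        (((fun u => ‖trigPoly w u‖ ^ 2) ∘ fun t => D * Real.sin t) t * (D * Real.cos t)) := by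
        refine intervalIntegral.integral_mono_on hle (Continuous.intervalIntegrable
          (by fun_prop) _ _) (Continuous.intervalIntegrable (by fun_prop) _ _) fun t ht => ?_
        have hcos : 1 / 2 ≤ Real.cos t := by
          rw [← Real.cos_pi_div_three, ← Real.cos_abs t]
          exact Real.cos_le_cos_of_nonneg_of_le_pi (abs_nonneg t) (by linarith)
            (abs_le.2 ⟨hθ.1.trans ht.1, ht.2.trans hθ.2⟩)
        have : 2 / D * (‖trigPoly w (D * Real.sin t)‖ ^ 2 * (D * Real.cos t)) =
            ‖trigPoly w (D * Real.sin t)‖ ^ 2 * (2 * Real.cos t) := by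
          field_simp
        simp only [Function.comp_apply]
        rw [this]
        exact le_mul_of_one_le_right (by positivity) (by linarith)
    _ = 2 / D * ∫ u in (D * Real.sin (θ - Δ))..(D * Real.sin (θ + Δ)), ‖trigPoly w u‖ ^ 2 := by
        rw [intervalIntegral.integral_const_mul, intervalIntegral.integral_comp_mul_deriv
          (fun t _ => (Real.hasDerivAt_sin t).const_mul D) (by fun_prop) (by fun_prop)]
    _ ≤ 2 / D * ∫ u in (-⌈D⌉₊ : ℝ)..⌈D⌉₊, ‖trigPoly w u‖ ^ 2 := by
        gcongr
        refine intervalIntegral.integral_mono_interval ?_ ?_ ?_ (ae_of_all _ fun u => sq_nonneg _)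
          (Continuous.intervalIntegrable (by fun_prop) _ _)
        · nlinarith [Real.neg_one_le_sin (θ - Δ)]
        · gcongr
          exact Real.sin_le_sin_of_le_of_le_pi_div_two (by linarith) (by linarith) hle
        · nlinarith [Real.sin_le_one (θ + Δ)]
    _ = _ := by
        rw [integral_normSq_trigPoly]
        ring

/-- The spectrum of the one-ring covariance is bounded uniformly in the number of antennas: the
density `1 / (D cos t)` of `D sin t` is bounded since `|t| ≤ π / 3`. -/
theorem exists_eigenvalues_ringCov_le (hD : 0 < D) (hΔ : 0 < Δ)
    (hθ : -(Real.pi / 3) ≤ θ - Δ ∧ θ + Δ ≤ Real.pi / 3) (L : ℕ) :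
    ∃ K : ℝ, ∀ n i, 0 ≤ (ringCov_isHermitian D Δ L θ n).eigenvalues i ∧
      (ringCov_isHermitian D Δ L θ n).eigenvalues i ≤ K := by
  refine ⟨1 / (2 * Δ * L) * (4 * ⌈D⌉₊ / D), fun n i => ?_⟩
  rw [Matrix.IsHermitian.eigenvalues_eq, star_dotProduct_ringCov_mulVec, RCLike.re_eq_complex_re,
    Complex.ofReal_re]
  constructor
  · refine mul_nonneg (by positivity) (intervalIntegral.integral_nonneg (by linarith) fun t _ =>
      sq_nonneg _)
  · gcongr
    refine (integral_normSq_trigPoly_sin_le hD hΔ hθ _).trans_eq ?_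
    have h1 := (ringCov_isHermitian D Δ L θ n).eigenvectorBasis.orthonormal.1 i
    have h2 := EuclideanSpace.norm_sq_eq ((ringCov_isHermitian D Δ L θ n).eigenvectorBasis i)
    rw [h1, one_pow] at h2
    simp only [Pi.star_apply, norm_star]
    rw [← h2, mul_one]

end ring

/-! ### Gram matrices of Gaussian rows. -/

section rows

open scoped Matrix.Norms.L2Operator

/-- Joint concentration of the Gram matrices, in a bounded geometry `Q n`, of finitely many rows
that are images, under bounded maps with orthogonal ranges, of one Gaussian vector. -/
theorem tendsto_gram {Ω : Type*} [MeasurableSpace Ω] {μ : Measure Ω} [IsProbabilityMeasure μ]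
    {ι m : ℕ → Type*} [∀ n, Fintype (ι n)] [∀ n, DecidableEq (ι n)] [∀ n, Fintype (m n)]
    [∀ n, DecidableEq (m n)] {α : Type*} [Fintype α] [DecidableEq α]
    {X : ∀ n, ι n → Ω → ℂ} (hX : ∀ n, IsIIDCN (X n) μ)
    {T : ∀ n, α → Matrix (ι n) (m n) ℂ} {Q : ∀ n, Matrix (m n) (m n) ℂ} {C C' K : ℝ}
    (hT : ∀ n a, ‖T n a‖ ≤ C) (hQ : ∀ n, ‖Q n‖ ≤ C')
    (hcard : ∀ n, (Fintype.card (ι n) : ℝ) ≤ K * n)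
    (horth : ∀ n a b, a ≠ b → (T n b)ᴴ * T n a = 0) :
    ∀ᵐ ω ∂μ, ∀ a b, Tendsto (fun n : ℕ =>
      (((X n · ω) ᵥ* T n a ᵥ* Q n) ⬝ᵥ star ((X n · ω) ᵥ* T n b) -
        if a = b then (T n a * Q n * (T n a)ᴴ).trace else 0) / n) atTop (𝓝 0) := by
  refine ae_all_iff.2 fun a => ae_all_iff.2 fun b => ?_
  have hC : 0 ≤ C := (norm_nonneg _).trans (hT 0 a)
  have hC' : 0 ≤ C' := (norm_nonneg _).trans (hQ 0)
  have hfro : ∀ n, ∑ i, ∑ j, ‖(T n a * Q n * (T n b)ᴴ) i j‖ ^ 2 ≤ K * (C * C' * C) ^ 2 * n := by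
    intro n
    have hn : ‖T n a * Q n * (T n b)ᴴ‖ ≤ C * C' * C := by
      refine (Matrix.l2_opNorm_mul _ _).trans ?_
      rw [Matrix.l2_opNorm_conjTranspose]
      have := (Matrix.l2_opNorm_mul (T n a) (Q n)).trans
        (mul_le_mul (hT n a) (hQ n) (norm_nonneg _) hC)
      exact mul_le_mul this (hT n b) (norm_nonneg _) (by positivity)
    refine (sum_normSq_le_card_mul _).trans ?_
    calc _ ≤ K * n * (C * C' * C) ^ 2 := by
          gcongr
          · exact (Nat.cast_nonneg _).trans (hcard n)
          · exact hcard n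
      _ = _ := by ring
  filter_upwards [tendsto_quadForm hX (fun n => T n a * Q n * (T n b)ᴴ) hfro] with ω hω
  refine hω.congr fun n => ?_
  have e1 : ((X n · ω) ᵥ* (T n a * Q n * (T n b)ᴴ)) ⬝ᵥ star (X n · ω) =
      ((X n · ω) ᵥ* T n a ᵥ* Q n) ⬝ᵥ star ((X n · ω) ᵥ* T n b) := by
    rw [← Matrix.vecMul_vecMul, ← Matrix.vecMul_vecMul, ← Matrix.dotProduct_mulVec,
      Matrix.star_vecMul]
  have e2 : (T n a * Q n * (T n b)ᴴ).trace =
      -- Off the diagonal, cyclicity brings `(T n b)ᴴ` next to `T n a`, and orthogonality kills the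
      -- mean.
      if a = b then (T n a * Q n * (T n a)ᴴ).trace else 0 := by
    split_ifs with hab
    · rw [hab]
    · rw [Matrix.trace_mul_comm, ← Matrix.mul_assoc, horth n a b hab, Matrix.zero_mul,
        Matrix.trace_zero]
  rw [e1, e2]

theorem norm_trace_mul_mul_conjTranspose_le {ι m : Type*} [Fintype ι] [Fintype m] [DecidableEq ι]
    [DecidableEq m] {T : Matrix ι m ℂ} {Q : Matrix m m ℂ} {C C' : ℝ} (hT : ‖T‖ ≤ C)
    (hQ : ‖Q‖ ≤ C') : ‖(T * Q * Tᴴ).trace‖ ≤ Fintype.card ι * (C * C' * C) := by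
  have hC : 0 ≤ C := (norm_nonneg _).trans hT
  have hC' : 0 ≤ C' := (norm_nonneg _).trans hQ
  refine (norm_trace_le_card_mul _).trans ?_
  gcongr
  refine (Matrix.l2_opNorm_mul _ _).trans ?_
  rw [Matrix.l2_opNorm_conjTranspose]
  exact mul_le_mul ((Matrix.l2_opNorm_mul T Q).trans (mul_le_mul hT hQ (norm_nonneg _) hC)) hT
    (norm_nonneg _) (by positivity)

end rows

/-- If the matrices `G x` approach the diagonal matrices of the `t x`, then so do their values at
bounded vectors. -/
theorem tendsto_sesqForm_sub_diagonal {α β : Type*} [Fintype α] [DecidableEq α] {l : Filter β}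
    {G : β → α → α → ℂ} {t : β → α → ℂ} {w : β → α → ℂ} {B : ℝ}
    (hG : ∀ a b, Tendsto (fun x => G x a b - if a = b then t x a else 0) l (𝓝 0))
    (hw : ∀ᶠ x in l, ∀ a, ‖w x a‖ ≤ B) :
    Tendsto (fun x => ∑ a, ∑ b, w x a * star (w x b) * G x a b -
      ∑ a, w x a * star (w x a) * t x a) l (𝓝 0) := by
  have h : ∀ x, ∑ a, ∑ b, w x a * star (w x b) * G x a b - ∑ a, w x a * star (w x a) * t x a =
      ∑ a, ∑ b, w x a * star (w x b) * (G x a b - if a = b then t x a else 0) := by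
    intro x
    simp only [mul_sub, Finset.sum_sub_distrib, mul_ite, mul_zero, Finset.sum_ite_eq,
      Finset.mem_univ, if_true]
  simp_rw [h]
  suffices hab : ∀ a b, Tendsto (fun x => w x a * star (w x b) *
      (G x a b - if a = b then t x a else 0)) l (𝓝 0) by
    simpa using tendsto_finsetSum Finset.univ fun a _ =>
      tendsto_finsetSum Finset.univ fun b _ => hab a b
  intro a b
  refine Tendsto.zero_mul_isBoundedUnder_le (hG a b) ?_ |>.congr fun x => mul_comm _ _
  refine isBoundedUnder_of_eventually_le (a := B * B) ?_
  filter_upwards [hw] with x hx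
  rw [Function.comp_apply, norm_mul, norm_star]
  exact mul_le_mul (hx a) (hx b) (norm_nonneg _) ((norm_nonneg _).trans (hx a))

/-- The coefficients factor out of the forms, so even random `w` needs only the convergence of a
finite Gram array. -/
theorem fMeasure_vecMul {n s : ℕ} {α : Type*} [Fintype α] (A : Matrix (Fin n) (Fin n) ℂ)
    (B : Matrix (Fin s) (Fin s) ℂ) (w : α → ℂ) (V : α → Fin n × Fin s → ℂ) :
    fMeasure A B (w ᵥ* Matrix.of V) =
      ∑ a, ∑ b, w a * star (w b) * ((V a ᵥ* (A ⊗ₖ B)) ⬝ᵥ star (V b)) := by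
  have h : w ᵥ* Matrix.of V = ∑ a, w a • V a := by
    ext y
    simp [Matrix.vecMul, dotProduct]
  rw [fMeasure, h, Matrix.sum_vecMul, star_sum, sum_dotProduct]
  refine Finset.sum_congr rfl fun a _ => ?_
  rw [dotProduct_sum]
  refine Finset.sum_congr rfl fun b _ => ?_
  rw [Matrix.smul_vecMul, star_smul, smul_dotProduct, dotProduct_smul, smul_eq_mul, smul_eq_mul,
    mul_assoc]

/-! ### Means of the channel forms. -/

section traces

variable {D Δ θ : ℝ} {N L s : ℕ} {p : Fin s → Fin N} {n : ℕ}

/-- The traces `n / L` and `s L` multiply to `n s`: a channel has the same mean energy as a row of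
unit noise, so the normalized Gram matrix tends to the identity. -/
theorem trace_channel_gram (hΔ : 0 < Δ) (hL : 0 < L)
    (h : ∀ i, 0 ≤ (ringCov_isHermitian D Δ L θ n).eigenvalues i) :
    ((hermSqrt (ringCov_isHermitian D Δ L θ n) ⊗ₖ (dftRows N L p)ᵀ) *
      (1 : Matrix (Fin n × Fin s) (Fin n × Fin s) ℂ) *
      (hermSqrt (ringCov_isHermitian D Δ L θ n) ⊗ₖ (dftRows N L p)ᵀ)ᴴ).trace = (n : ℂ) * s := by
  have hL' : (L : ℂ) ≠ 0 := by exact_mod_cast hL.ne'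
  have h1 := trace_hermSqrt_mul_mul (ringCov_isHermitian D Δ L θ n) h 1
  rw [Matrix.mul_one, Matrix.mul_one, trace_ringCov hΔ] at h1
  rw [Matrix.mul_one, Matrix.conjTranspose_kronecker, ← Matrix.mul_kronecker_mul,
    Matrix.trace_kronecker, h1, trace_dftRows_mul_conjTranspose]
  field_simp

theorem trace_channel_pseudoInv (hs : L ≤ s) (hp : Function.Injective p)
    (S Q : Matrix (Fin n) (Fin n) ℂ) :
    ((S ⊗ₖ (dftRows N L p)ᵀ) * (Q ⊗ₖ pseudoInv (freqCov_isHermitian (dftRows N L p))) *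
      (S ⊗ₖ (dftRows N L p)ᵀ)ᴴ).trace = (L : ℂ) * (S * Q * Sᴴ).trace := by
  rw [Matrix.conjTranspose_kronecker, ← Matrix.mul_kronecker_mul, ← Matrix.mul_kronecker_mul,
    Matrix.trace_kronecker, dftRows_mul_pseudoInv_mul hs hp, Matrix.trace_one, Fintype.card_fin,
    mul_comm]

end traces

/-! ### Block embeddings, and channels observed with Gaussian error. -/

section noisy

open scoped Matrix.Norms.L2Operator

theorem vecMul_one_submatrix_mul {ι κ m : Type*} [Fintype ι] [Fintype κ] [DecidableEq ι]
    (e : κ → ι) (S : Matrix κ m ℂ) (v : ι → ℂ) :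
    v ᵥ* ((1 : Matrix ι ι ℂ).submatrix id e * S) = (fun k => v (e k)) ᵥ* S := by
  rw [← Matrix.vecMul_vecMul, vecMul_one_submatrix]

theorem norm_one_submatrix_mul_le {ι κ m : Type*} [Fintype ι] [Fintype κ] [Fintype m]
    [DecidableEq ι] [DecidableEq κ] [DecidableEq m] {e : κ → ι} (he : Function.Injective e)
    (S : Matrix κ m ℂ) : ‖(1 : Matrix ι ι ℂ).submatrix id e * S‖ ≤ ‖S‖ := by
  refine (Matrix.l2_opNorm_mul _ _).trans ?_
  calc _ ≤ 1 * ‖S‖ := by gcongr; exact norm_one_submatrix_le he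
    _ = _ := one_mul _

theorem conjTranspose_one_submatrix_mul {ι κ κ' m : Type*} [Fintype ι] [Fintype κ] [Fintype κ']
    [DecidableEq ι] {e : κ → ι} {e' : κ' → ι} (h : ∀ k k', e k ≠ e' k')
    (S : Matrix κ m ℂ) (S' : Matrix κ' m ℂ) :
    ((1 : Matrix ι ι ℂ).submatrix id e * S)ᴴ * ((1 : Matrix ι ι ℂ).submatrix id e' * S') = 0 := by
  have h0 : ((1 : Matrix ι ι ℂ).submatrix id e)ᴴ * (1 : Matrix ι ι ℂ).submatrix id e' = 0 := by
    rw [Matrix.conjTranspose_submatrix, Matrix.conjTranspose_one,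
      ← Matrix.submatrix_mul _ _ _ _ _ Function.bijective_id, Matrix.one_mul]
    ext k k'
    simp [h]
  rw [Matrix.conjTranspose_mul, Matrix.mul_assoc, ← Matrix.mul_assoc _ _ S', h0, Matrix.zero_mul,
    Matrix.mul_zero]

theorem trace_one_submatrix_mul {ι κ m : Type*} [Fintype ι] [Fintype κ] [Fintype m]
    [DecidableEq ι] [DecidableEq κ] {e : κ → ι} (he : Function.Injective e)
    (S : Matrix κ m ℂ) (Q : Matrix m m ℂ) :
    (((1 : Matrix ι ι ℂ).submatrix id e * S) * Q *
      ((1 : Matrix ι ι ℂ).submatrix id e * S)ᴴ).trace = (S * Q * Sᴴ).trace := by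
  have h0 : ((1 : Matrix ι ι ℂ).submatrix id e)ᴴ * (1 : Matrix ι ι ℂ).submatrix id e = 1 := by
    rw [Matrix.conjTranspose_submatrix, Matrix.conjTranspose_one,
      ← Matrix.submatrix_mul _ _ _ _ _ Function.bijective_id, Matrix.one_mul,
      Matrix.submatrix_one _ he]
  rw [Matrix.conjTranspose_mul, ← Matrix.mul_assoc, Matrix.trace_mul_comm, ← Matrix.mul_assoc,
    ← Matrix.mul_assoc, ← Matrix.mul_assoc, h0, Matrix.one_mul]

theorem norm_one_le {ι : Type*} [Fintype ι] [DecidableEq ι] : ‖(1 : Matrix ι ι ℂ)‖ ≤ 1 := by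
  have := norm_one_submatrix_le (Function.injective_id (α := ι))
  rwa [Matrix.submatrix_id_id] at this

/-- The measure of a channel observed with an independent Gaussian error. -/
theorem tendsto_fMeasure_channel_sub_noise {Ω : Type*} [MeasurableSpace Ω] {μ : Measure Ω}
    [IsProbabilityMeasure μ] {L s : ℕ} {g : ∀ n : ℕ, Fin n × Fin L → Ω → ℂ}
    {w : ∀ n : ℕ, Fin n × Fin s → Ω → ℂ} (hiid : ∀ n, IsIIDCN (Sum.elim (g n) (w n)) μ)
    {S A : ∀ n : ℕ, Matrix (Fin n) (Fin n) ℂ} {C C' : ℝ} (hS : ∀ n, ‖S n‖ ≤ C)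
    (hA : ∀ n, ‖A n‖ ≤ C') (M : Matrix (Fin L) (Fin s) ℂ) (B : Matrix (Fin s) (Fin s) ℂ)
    {ε : ℕ → ℝ} {E : ℝ} (hε : ∀ n, |ε n| ≤ E) :
    ∀ᵐ ω ∂μ, Tendsto (fun n : ℕ => (fMeasure (A n) B
        ((fun i => g n i ω) ᵥ* (S n ⊗ₖ M) - (ε n : ℂ) • (fun i => w n i ω)) -
      (((S n ⊗ₖ M) * (A n ⊗ₖ B) * (S n ⊗ₖ M)ᴴ).trace + (ε n : ℂ) ^ 2 * (A n ⊗ₖ B).trace)) / n)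
      atTop (𝓝 0) := by
  let I : ℕ → Type := fun n => (Fin n × Fin L) ⊕ (Fin n × Fin s)
  -- Channel and error are two images of the joint vector `(g, w)`; the estimate combines them with
  -- coefficients `1` and `-ε`.
  let T : ∀ n, Fin 2 → Matrix (I n) (Fin n × Fin s) ℂ := fun n =>
    ![(1 : Matrix (I n) (I n) ℂ).submatrix id Sum.inl * (S n ⊗ₖ M),
      (1 : Matrix (I n) (I n) ℂ).submatrix id Sum.inr *
        (1 : Matrix (Fin n × Fin s) (Fin n × Fin s) ℂ)]
  have hC : 0 ≤ C := (norm_nonneg _).trans (hS 0)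
  have hC' : 0 ≤ C' := (norm_nonneg _).trans (hA 0)
  have hT : ∀ n a, ‖T n a‖ ≤ max (C * ‖M‖) 1 := by
    intro n a
    fin_cases a
    · refine (norm_one_submatrix_mul_le Sum.inl_injective _).trans ?_
      refine (norm_kronecker_le _ _).trans (le_max_of_le_left ?_)
      gcongr
      exact hS n
    · exact (norm_one_submatrix_mul_le Sum.inr_injective _).trans (le_max_of_le_right norm_one_le)
  have hQ : ∀ n, ‖A n ⊗ₖ B‖ ≤ C' * ‖B‖ := fun n =>
    (norm_kronecker_le _ _).trans (by gcongr; exact hA n)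
  have hcard : ∀ n, (Fintype.card (I n) : ℝ) ≤ (L + s : ℝ) * n := by
    intro n
    simp only [I, Fintype.card_sum, Fintype.card_prod, Fintype.card_fin]
    push_cast
    linarith
  have horth : ∀ n a b, a ≠ b → (T n b)ᴴ * T n a = 0 := by
    intro n a b hab
    fin_cases a <;> fin_cases b
    · exact absurd rfl hab
    · exact conjTranspose_one_submatrix_mul (fun _ _ => Sum.inr_ne_inl) _ _
    · exact conjTranspose_one_submatrix_mul (fun _ _ => Sum.inl_ne_inr) _ _
    · exact absurd rfl hab
  filter_upwards [tendsto_gram hiid hT hQ hcard horth] with ω hω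
  have hw : ∀ᶠ n in atTop, ∀ a, ‖(![1, -(ε n : ℂ)] : Fin 2 → ℂ) a‖ ≤ max 1 E := by
    refine Eventually.of_forall fun n a => ?_
    fin_cases a
    · simp
    · simpa using Or.inr (hε n)
  have key := tendsto_sesqForm_sub_diagonal
    (G := fun n a b => (((fun i => Sum.elim (g n) (w n) i ω) ᵥ* T n a ᵥ* (A n ⊗ₖ B)) ⬝ᵥ
      star ((fun i => Sum.elim (g n) (w n) i ω) ᵥ* T n b)) / n)
    (t := fun n a => (T n a * (A n ⊗ₖ B) * (T n a)ᴴ).trace / n)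
    (fun a b => (hω a b).congr fun n => by
      rw [sub_div]
      congr 1
      split_ifs <;> simp) hw
  refine key.congr fun n => ?_
  have hvec : (fun i => g n i ω) ᵥ* (S n ⊗ₖ M) - (ε n : ℂ) • (fun i => w n i ω) =
      (![1, -(ε n : ℂ)] : Fin 2 → ℂ) ᵥ*
        Matrix.of fun a => (fun i => Sum.elim (g n) (w n) i ω) ᵥ* T n a := by
    have h0 : (fun i => Sum.elim (g n) (w n) i ω) ᵥ* T n 0 = (fun i => g n i ω) ᵥ* (S n ⊗ₖ M) :=
      vecMul_one_submatrix_mul _ _ _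
    have h1 : (fun i => Sum.elim (g n) (w n) i ω) ᵥ* T n 1 = fun i => w n i ω :=
      (vecMul_one_submatrix_mul _ _ _).trans (Matrix.vecMul_one _)
    have hsum : ((![1, -(ε n : ℂ)] : Fin 2 → ℂ) ᵥ*
        Matrix.of fun a => (fun i => Sum.elim (g n) (w n) i ω) ᵥ* T n a) =
        (1 : ℂ) • ((fun i => Sum.elim (g n) (w n) i ω) ᵥ* T n 0) +
          (-(ε n : ℂ)) • ((fun i => Sum.elim (g n) (w n) i ω) ᵥ* T n 1) := by
      ext y
      exact Fin.sum_univ_two fun a => (![1, -(ε n : ℂ)] : Fin 2 → ℂ) a *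
        ((fun i => Sum.elim (g n) (w n) i ω) ᵥ* T n a) y
    rw [hsum, h0, h1, one_smul, neg_smul, sub_eq_add_neg]
  rw [hvec, fMeasure_vecMul, sub_div, Finset.sum_div]
  congr 1
  · refine Finset.sum_congr rfl fun a _ => ?_
    rw [Finset.sum_div]
    exact Finset.sum_congr rfl fun b _ => (mul_div_assoc _ _ _).symm
  · have h0 : (T n 0 * (A n ⊗ₖ B) * (T n 0)ᴴ).trace =
        ((S n ⊗ₖ M) * (A n ⊗ₖ B) * (S n ⊗ₖ M)ᴴ).trace :=
      trace_one_submatrix_mul Sum.inl_injective _ _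
    have h1 : (T n 1 * (A n ⊗ₖ B) * (T n 1)ᴴ).trace = (A n ⊗ₖ B).trace :=
      (trace_one_submatrix_mul Sum.inr_injective _ _).trans (by simp)
    rw [Fin.sum_univ_two, h0, h1]
    simp
    ring

end noisy

/-! ### Estimates from the received signal. -/

/-- The matrix `[X σI]` applied to the channels and the normalized noise. -/
noncomputable def noisyPilots (X : Matrix (Fin 2) (Fin 2) ℂ) (σ : ℝ) :
    Matrix (Fin 2) (Fin 2 ⊕ Fin 2) ℂ :=
  Matrix.fromCols X ((σ : ℂ) • (1 : Matrix (Fin 2) (Fin 2) ℂ))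

theorem pilots_mul_add_smul_noise {n s : ℕ} (X : Matrix (Fin 2) (Fin 2) ℂ)
    (H : Fin 2 → Fin n × Fin s → ℂ) (σ : ℝ) (Z : Fin 2 × (Fin n × Fin s) → ℂ) :
    X * Matrix.of H + (σ : ℂ) • Matrix.of (fun k a => Z (k, a)) =
      noisyPilots X σ * Matrix.of (Sum.elim H fun k a => Z (k, a)) := by
  ext k y
  simp [noisyPilots, Matrix.mul_apply, Matrix.one_apply]

theorem continuous_noisyPilots (X : Matrix (Fin 2) (Fin 2) ℂ) : Continuous (noisyPilots X) := by
  refine continuous_pi fun k => continuous_pi fun a => ?_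
  rcases a with a | a
  · simp only [noisyPilots, Matrix.fromCols_apply_inl]
    exact continuous_const
  · simp only [noisyPilots, Matrix.fromCols_apply_inr, Matrix.smul_apply, smul_eq_mul]
    fun_prop

theorem tendsto_mul_mul_conjTranspose {β m n : Type*} [Fintype n] {l : Filter β}
    {P : β → Matrix m n ℂ} {G : β → Matrix n n ℂ} {P₀ : Matrix m n ℂ} {G₀ : Matrix n n ℂ}
    (hP : Tendsto P l (𝓝 P₀)) (hG : Tendsto G l (𝓝 G₀)) :
    Tendsto (fun x => P x * G x * (P x)ᴴ) l (𝓝 (P₀ * G₀ * P₀ᴴ)) := by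
  have hP' : ∀ a b, Tendsto (fun x => P x a b) l (𝓝 (P₀ a b)) := fun a b =>
    tendsto_pi_nhds.1 (tendsto_pi_nhds.1 hP a) b
  have hG' : ∀ a b, Tendsto (fun x => G x a b) l (𝓝 (G₀ a b)) := fun a b =>
    tendsto_pi_nhds.1 (tendsto_pi_nhds.1 hG a) b
  refine tendsto_pi_nhds.2 fun a => tendsto_pi_nhds.2 fun b => ?_
  simp only [Matrix.mul_apply, Matrix.conjTranspose_apply]
  exact tendsto_finsetSum _ fun i _ =>
    (tendsto_finsetSum _ fun k _ => (hP' a k).mul (hG' k i)).mul (hP' b i).star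

/-- The combiner that isolates the user `j` when the empirical Gram matrix of the channels and of
the noise tends to the identity and the noise level tends to zero. -/
theorem tendsto_combiner {β : Type*} {l : Filter β} {X : Matrix (Fin 2) (Fin 2) ℂ}
    (hX : X.det ≠ 0) (j : Fin 2) {G : β → Matrix (Fin 2 ⊕ Fin 2) (Fin 2 ⊕ Fin 2) ℂ}
    {σ : β → ℝ} (hG : Tendsto G l (𝓝 1)) (hσ : Tendsto σ l (𝓝 0)) :
    Tendsto (fun x => (star (fun k => X k j) ᵥ*
      (noisyPilots X (σ x) * G x * (noisyPilots X (σ x))ᴴ)⁻¹) ᵥ* noisyPilots X (σ x)) l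
      (𝓝 (Sum.elim (Pi.single j 1) 0)) := by
  have hP : Tendsto (fun x => noisyPilots X (σ x)) l (𝓝 (noisyPilots X 0)) :=
    ((continuous_noisyPilots X).tendsto 0).comp hσ
  have hP0 : noisyPilots X 0 = Matrix.fromCols X 0 := by simp [noisyPilots]
  have hC := tendsto_mul_mul_conjTranspose hP hG
  have h2 : noisyPilots X 0 * (1 : Matrix (Fin 2 ⊕ Fin 2) (Fin 2 ⊕ Fin 2) ℂ) * (noisyPilots X 0)ᴴ = X * Xᴴ := by
    ext a b
    rw [Matrix.mul_one]
    simp [hP0, Matrix.mul_apply]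
  rw [h2] at hC
  have hdet : (X * Xᴴ).det ≠ 0 := by
    rw [Matrix.det_mul, Matrix.det_conjTranspose]
    exact mul_ne_zero hX (star_ne_zero.2 hX)
  have hinv : ContinuousAt (fun M : Matrix (Fin 2) (Fin 2) ℂ => M⁻¹) (X * Xᴴ) := by
    simp only [Matrix.inv_def, Ring.inverse_eq_inv']
    refine ContinuousAt.smul (ContinuousAt.inv₀ ?_ hdet) ?_ <;> fun_prop
  have hc : Continuous (fun M : Matrix (Fin 2) (Fin 2) ℂ × Matrix (Fin 2) (Fin 2 ⊕ Fin 2) ℂ =>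
      (star (fun k => X k j) ᵥ* M.1) ᵥ* M.2) := by fun_prop
  have h1 := (hc.tendsto ((X * Xᴴ)⁻¹, noisyPilots X 0)).comp
    ((hinv.tendsto.comp hC).prodMk_nhds hP)
  have hunit : IsUnit X.det := isUnit_iff_ne_zero.2 hX
  have hunit' : IsUnit (Xᴴ).det := by
    rw [Matrix.det_conjTranspose]
    exact isUnit_iff_ne_zero.2 (star_ne_zero.2 hX)
  have h3 : (star (fun k => X k j) ᵥ* (X * Xᴴ)⁻¹) ᵥ* noisyPilots X 0 =
      Sum.elim (Pi.single j 1) 0 := by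
    -- Hence `x_jᴴ (X Xᴴ)⁻¹ X = e_jᵀ Xᴴ (Xᴴ)⁻¹ X⁻¹ X = e_jᵀ`.
    have h4 : star (fun k => X k j) = Pi.single j 1 ᵥ* Xᴴ := by
      ext k
      simp
    rw [Matrix.mul_inv_rev, h4, Matrix.vecMul_vecMul (Pi.single j 1) Xᴴ, ← Matrix.mul_assoc,
      Matrix.mul_nonsing_inv _ hunit', Matrix.one_mul, hP0, Matrix.vecMul_fromCols,
      Matrix.vecMul_vecMul, Matrix.nonsing_inv_mul _ hunit, Matrix.vecMul_one,
      Matrix.vecMul_zero]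
  simp only [h3] at h1
  exact h1

/-- Consistency, up to the channel's own fluctuation, of the estimate from the received signal. -/
theorem tendsto_fMeasure_estimate {s : ℕ} (hs : 0 < s) {X : Matrix (Fin 2) (Fin 2) ℂ}
    (hX : X.det ≠ 0) (j : Fin 2) {R : ∀ n, Matrix (Fin n) (Fin n) ℂ}
    {RF : Matrix (Fin s) (Fin s) ℂ}
    (hR : ∀ n : ℕ, 0 < n → (R n).trace * RF.trace / ((n : ℂ) * s) = 1)
    {A : ∀ n, Matrix (Fin n) (Fin n) ℂ} {B : Matrix (Fin s) (Fin s) ℂ}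
    {H : ∀ n, Fin 2 → Fin n × Fin s → ℂ} {Z : ∀ n, Fin 2 × (Fin n × Fin s) → ℂ}
    (hΓ : ∀ a b, Tendsto (fun n : ℕ =>
      (Sum.elim (H n) (fun k y => Z n (k, y)) a ⬝ᵥ
        star (Sum.elim (H n) (fun k y => Z n (k, y)) b) -
        if a = b then (n : ℂ) * s else 0) / n) atTop (𝓝 0))
    {t : ℕ → Fin 2 ⊕ Fin 2 → ℂ} {K : ℝ} (ht : ∀ n a, ‖t n a‖ ≤ K * n)
    (hG : ∀ a b, Tendsto (fun n : ℕ =>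
      ((Sum.elim (H n) (fun k y => Z n (k, y)) a ᵥ* (A n ⊗ₖ B)) ⬝ᵥ
        star (Sum.elim (H n) (fun k y => Z n (k, y)) b) -
        if a = b then t n a else 0) / n) atTop (𝓝 0)) :
    Tendsto (fun q : ℕ × ℝ => (fMeasure (A q.1) B (estimate (R q.1) RF (fun k => X k j)
      (X * Matrix.of (H q.1) + (q.2 : ℂ) • Matrix.of fun k a => Z q.1 (k, a))) -
        t q.1 (Sum.inl j)) / q.1) (atTop ×ˢ 𝓝[≥] 0) (𝓝 0) := by
  have hs' : (s : ℂ) ≠ 0 := by exact_mod_cast hs.ne'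
  set V : ∀ n, Fin 2 ⊕ Fin 2 → Fin n × Fin s → ℂ :=
    fun n => Sum.elim (H n) (fun k y => Z n (k, y)) with hV
  set Γ : ℕ → Matrix (Fin 2 ⊕ Fin 2) (Fin 2 ⊕ Fin 2) ℂ := fun n =>
    (1 / ((n : ℂ) * s)) • (Matrix.of (V n) * (Matrix.of (V n))ᴴ) with hΓdef
  have hΓlim : Tendsto Γ atTop (𝓝 1) := by
    refine tendsto_pi_nhds.2 fun a => tendsto_pi_nhds.2 fun b => ?_
    have h1 := ((hΓ a b).div_const (s : ℂ)).add_const ((1 : Matrix _ _ ℂ) a b)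
    rw [zero_div, zero_add] at h1
    refine h1.congr' ?_
    filter_upwards [eventually_gt_atTop 0] with n hn
    have hn' : (n : ℂ) ≠ 0 := by exact_mod_cast hn.ne'
    have : Γ n a b = 1 / ((n : ℂ) * s) * (V n a ⬝ᵥ star (V n b)) := by
      simp [hΓdef, Matrix.mul_apply, dotProduct]
    rw [this, Matrix.one_apply]
    split_ifs <;> field_simp <;> ring
  have hfst : Tendsto (fun q : ℕ × ℝ => q.1) (atTop ×ˢ 𝓝[≥] (0 : ℝ)) atTop := tendsto_fst
  have hsnd : Tendsto (fun q : ℕ × ℝ => q.2) (atTop ×ˢ 𝓝[≥] (0 : ℝ)) (𝓝 0) :=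
    tendsto_snd.mono_right nhdsWithin_le_nhds
  have hcov : ∀ (q : ℕ × ℝ) (P : Matrix (Fin 2) (Fin 2 ⊕ Fin 2) ℂ),
      sampleCov (P * Matrix.of (V q.1)) = P * Γ q.1 * Pᴴ := by
    intro q P
    simp only [sampleCov, hΓdef, Matrix.conjTranspose_mul, Matrix.mul_smul, Matrix.smul_mul,
      Matrix.mul_assoc]
  obtain ⟨w, hwdef, hwlim⟩ : ∃ w : ℕ × ℝ → Fin 2 ⊕ Fin 2 → ℂ, (∀ q, w q =
      (star (fun k => X k j) ᵥ* (noisyPilots X q.2 * Γ q.1 * (noisyPilots X q.2)ᴴ)⁻¹) ᵥ*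
        noisyPilots X q.2) ∧
      Tendsto w (atTop ×ˢ 𝓝[≥] (0 : ℝ)) (𝓝 (Sum.elim (Pi.single j 1) 0)) :=
    ⟨_, fun _ => rfl, tendsto_combiner hX j (hΓlim.comp hfst) hsnd⟩
  have hwa : ∀ a, Tendsto (fun q => w q a) (atTop ×ˢ 𝓝[≥] (0 : ℝ))
      (𝓝 ((Sum.elim (Pi.single j 1) 0 : Fin 2 ⊕ Fin 2 → ℂ) a)) := tendsto_pi_nhds.1 hwlim
  have hlim_le : ∀ a, ‖(Sum.elim (Pi.single j 1) 0 : Fin 2 ⊕ Fin 2 → ℂ) a‖ < 2 := by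
    rintro (a | a)
    · rw [Sum.elim_inl, Pi.single_apply]
      split_ifs <;> norm_num
    · simp
  -- The limit has entries of modulus at most 1, so any bound above 1 holds eventually.
  have hwb : ∀ᶠ q in atTop ×ˢ 𝓝[≥] (0 : ℝ), ∀ a, ‖w q a‖ ≤ 2 :=
    eventually_all.2 fun a => ((hwa a).norm.eventually_lt_const (hlim_le a)).mono fun q hq => hq.le
  have key := tendsto_sesqForm_sub_diagonal
    (G := fun (q : ℕ × ℝ) a b => ((V q.1 a ᵥ* (A q.1 ⊗ₖ B)) ⬝ᵥ star (V q.1 b)) / q.1)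
    (t := fun q a => t q.1 a / q.1)
    (fun a b => ((hG a b).comp hfst).congr fun q => by
      rw [Function.comp_apply, sub_div]
      congr 1
      split_ifs <;> simp) hwb
  -- Because `t / n` is bounded by `ht`, replacing the combiner by its limit costs o(1) and leaves
  -- only the term of user `j`.
  have hdiag : Tendsto (fun q : ℕ × ℝ => ∑ a, w q a * star (w q a) * (t q.1 a / q.1) -
      t q.1 (Sum.inl j) / q.1) (atTop ×ˢ 𝓝[≥] (0 : ℝ)) (𝓝 0) := by
    set e : Fin 2 ⊕ Fin 2 → ℂ := Sum.elim (Pi.single j 1) 0 with he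
    have h1 : ∀ q : ℕ × ℝ, ∑ a, (w q a * star (w q a) - e a * star (e a)) * (t q.1 a / q.1) =
        ∑ a, w q a * star (w q a) * (t q.1 a / q.1) - t q.1 (Sum.inl j) / q.1 := by
      intro q
      simp_rw [sub_mul]
      rw [Finset.sum_sub_distrib]
      congr 1
      rw [Finset.sum_eq_single (Sum.inl j)]
      · simp [he]
      · rintro (a | a) _ ha
        · have : a ≠ j := fun h => ha (by rw [h])
          simp [he, this]
        · simp [he]
      · simp
    refine Tendsto.congr h1 ?_
    suffices ha : ∀ a, Tendsto (fun q : ℕ × ℝ =>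
        (w q a * star (w q a) - e a * star (e a)) * (t q.1 a / q.1))
        (atTop ×ˢ 𝓝[≥] (0 : ℝ)) (𝓝 0) by
      simpa using tendsto_finsetSum Finset.univ fun a _ => ha a
    intro a
    refine Tendsto.zero_mul_isBoundedUnder_le ?_ ?_
    · have := ((hwa a).mul (hwa a).star).sub_const (e a * star (e a))
      rwa [sub_self] at this
    · refine isBoundedUnder_of_eventually_le (a := |K|) (Eventually.of_forall fun q => ?_)
      rw [Function.comp_apply, norm_div, Complex.norm_natCast]
      refine div_le_of_le_mul₀ (by positivity) (by positivity) ((ht q.1 a).trans ?_)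
      gcongr
      exact le_abs_self K
  have h3 := key.add hdiag
  rw [add_zero] at h3
  refine h3.congr' ?_
  -- The scalar `T_k` equals 1 only for `n > 0`; at `n = 0` it would be a division by zero.
  filter_upwards [hfst.eventually (eventually_gt_atTop 0)] with q hq
  have hest : estimate (R q.1) RF (fun k => X k j)
      (X * Matrix.of (H q.1) + (q.2 : ℂ) • Matrix.of fun k a => Z q.1 (k, a)) =
        w q ᵥ* Matrix.of (V q.1) := by
    rw [pilots_mul_add_smul_noise, estimate, hR q.1 hq, one_smul, hcov, hwdef, Matrix.vecMul_vecMul,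
      Matrix.vecMul_vecMul, Matrix.vecMul_vecMul]
  rw [hest, fMeasure_vecMul, sub_add_sub_cancel, sub_div, Finset.sum_div]
  congr 1
  refine Finset.sum_congr rfl fun a _ => ?_
  rw [Finset.sum_div]
  exact Finset.sum_congr rfl fun b _ => (mul_div_assoc _ _ _).symm

section received

open scoped Matrix.Norms.L2Operator

/-- The measure of the estimates of two independent channels from the received signal. -/
theorem tendsto_fMeasure_received {Ω : Type*} [MeasurableSpace Ω] {μ : Measure Ω}
    [IsProbabilityMeasure μ] {L s : ℕ} (hs : 0 < s) {gB gA : ∀ n : ℕ, Fin n × Fin L → Ω → ℂ}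
    {Z : ∀ n : ℕ, Fin 2 × (Fin n × Fin s) → Ω → ℂ}
    (hiid : ∀ n, IsIIDCN (Sum.elim (gB n) (Sum.elim (gA n) (Z n))) μ)
    {X : Matrix (Fin 2) (Fin 2) ℂ} (hX : X.det ≠ 0)
    {R S : Fin 2 → ∀ n : ℕ, Matrix (Fin n) (Fin n) ℂ} {A : ∀ n : ℕ, Matrix (Fin n) (Fin n) ℂ}
    {C C' : ℝ} (hS : ∀ j n, ‖S j n‖ ≤ C) (hA : ∀ n, ‖A n‖ ≤ C')
    {M : Matrix (Fin L) (Fin s) ℂ} (B RF : Matrix (Fin s) (Fin s) ℂ)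
    (hR : ∀ j, ∀ n : ℕ, 0 < n → (R j n).trace * RF.trace / ((n : ℂ) * s) = 1)
    (hM : ∀ j n, ((S j n ⊗ₖ M) * (1 : Matrix (Fin n × Fin s) (Fin n × Fin s) ℂ) *
      (S j n ⊗ₖ M)ᴴ).trace = (n : ℂ) * s) :
    ∀ᵐ ω ∂μ, ∀ j, Tendsto (fun q : ℕ × ℝ => (fMeasure (A q.1) B
        (estimate (R j q.1) RF (fun k => X k j) (received X
          ((fun i => gB q.1 i ω) ᵥ* (S 0 q.1 ⊗ₖ M)) ((fun i => gA q.1 i ω) ᵥ* (S 1 q.1 ⊗ₖ M))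
          q.2 (fun i => Z q.1 i ω))) -
        ((S j q.1 ⊗ₖ M) * (A q.1 ⊗ₖ B) * (S j q.1 ⊗ₖ M)ᴴ).trace) / q.1)
      (atTop ×ˢ 𝓝[≥] 0) (𝓝 0) := by
  let I : ℕ → Type := fun n => (Fin n × Fin L) ⊕ ((Fin n × Fin L) ⊕ (Fin 2 × (Fin n × Fin s)))
  let eA : ∀ n, Fin n × Fin L → I n := fun n x => Sum.inr (Sum.inl x)
  let eZ : ∀ n, Fin 2 → Fin n × Fin s → I n := fun n k y => Sum.inr (Sum.inr (k, y))
  have heB : ∀ n, Function.Injective (Sum.inl : Fin n × Fin L → I n) := fun n => Sum.inl_injective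
  have heA : ∀ n, Function.Injective (eA n) := fun n => Sum.inr_injective.comp Sum.inl_injective
  have heZ : ∀ n k, Function.Injective (eZ n k) := fun n k =>
    Sum.inr_injective.comp (Sum.inr_injective.comp (Prod.mk_right_injective k))
  let T : ∀ n, Fin 2 ⊕ Fin 2 → Matrix (I n) (Fin n × Fin s) ℂ := fun n =>
    Sum.elim ![(1 : Matrix (I n) (I n) ℂ).submatrix id Sum.inl * (S 0 n ⊗ₖ M),
      (1 : Matrix (I n) (I n) ℂ).submatrix id (eA n) * (S 1 n ⊗ₖ M)]
      fun k => (1 : Matrix (I n) (I n) ℂ).submatrix id (eZ n k) *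
        (1 : Matrix (Fin n × Fin s) (Fin n × Fin s) ℂ)
  have hC : 0 ≤ C := (norm_nonneg _).trans (hS 0 0)
  have hC' : 0 ≤ C' := (norm_nonneg _).trans (hA 0)
  have hSM : ∀ j n, ‖S j n ⊗ₖ M‖ ≤ C * ‖M‖ := fun j n =>
    (norm_kronecker_le _ _).trans (by gcongr; exact hS j n)
  have hT : ∀ n a, ‖T n a‖ ≤ max (C * ‖M‖) 1 := by
    rintro n (a | a)
    · fin_cases a
      · exact (norm_one_submatrix_mul_le (heB n) _).trans (le_max_of_le_left (hSM 0 n))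
      · exact (norm_one_submatrix_mul_le (heA n) _).trans (le_max_of_le_left (hSM 1 n))
    · exact (norm_one_submatrix_mul_le (heZ n a) _).trans (le_max_of_le_right norm_one_le)
  have hQ : ∀ n, ‖A n ⊗ₖ B‖ ≤ C' * ‖B‖ := fun n =>
    (norm_kronecker_le _ _).trans (by gcongr; exact hA n)
  have hcard : ∀ n, (Fintype.card (I n) : ℝ) ≤ (2 * L + 2 * s : ℝ) * n := by
    intro n
    simp only [I, Fintype.card_sum, Fintype.card_prod, Fintype.card_fin]
    push_cast
    linarith
  have horth : ∀ n a b, a ≠ b → (T n b)ᴴ * T n a = 0 := by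
    rintro n (a | a) (b | b) hab
    · fin_cases a <;> fin_cases b
      · exact absurd rfl hab
      · exact conjTranspose_one_submatrix_mul (fun _ _ => Sum.inr_ne_inl) _ _
      · exact conjTranspose_one_submatrix_mul (fun _ _ => Sum.inl_ne_inr) _ _
      · exact absurd rfl hab
    · fin_cases a
      · exact conjTranspose_one_submatrix_mul (fun _ _ => Sum.inr_ne_inl) _ _
      · exact conjTranspose_one_submatrix_mul
          (fun _ _ h => Sum.inr_ne_inl (Sum.inr_injective h)) _ _
    · fin_cases b
      · exact conjTranspose_one_submatrix_mul (fun _ _ => Sum.inl_ne_inr) _ _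
      · exact conjTranspose_one_submatrix_mul
          (fun _ _ h => Sum.inl_ne_inr (Sum.inr_injective h)) _ _
    · refine conjTranspose_one_submatrix_mul (fun _ _ h => hab ?_) _ _
      exact congrArg Sum.inr (Prod.ext_iff.1 (Sum.inr_injective (Sum.inr_injective h))).1.symm
  have htr : ∀ n (Q : Matrix (Fin n × Fin s) (Fin n × Fin s) ℂ) j,
      (T n (Sum.inl j) * Q * (T n (Sum.inl j))ᴴ).trace =
        ((S j n ⊗ₖ M) * Q * (S j n ⊗ₖ M)ᴴ).trace := by
    intro n Q j
    fin_cases j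
    · exact trace_one_submatrix_mul (heB n) _ _
    · exact trace_one_submatrix_mul (heA n) _ _
  have htrOne : ∀ n a, (T n a * (1 : Matrix (Fin n × Fin s) (Fin n × Fin s) ℂ) *
      (T n a)ᴴ).trace = (n : ℂ) * s := by
    rintro n (a | a)
    · rw [htr, hM]
    · exact (trace_one_submatrix_mul (heZ n a) _ _).trans (by simp)
  -- Two geometries are needed on the same rows: `A ⊗ B` for the measure and the identity for the
  -- sample covariance.
  filter_upwards [tendsto_gram hiid hT hQ hcard horth,
    tendsto_gram hiid hT (fun n => norm_one_le) hcard horth] with ω hG hΓ j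
  have hV : ∀ n a, (fun i => Sum.elim (gB n) (Sum.elim (gA n) (Z n)) i ω) ᵥ* T n a =
      Sum.elim ![(fun i => gB n i ω) ᵥ* (S 0 n ⊗ₖ M), (fun i => gA n i ω) ᵥ* (S 1 n ⊗ₖ M)]
        (fun k y => Z n (k, y) ω) a := by
    rintro n (a | a)
    · fin_cases a
      · exact vecMul_one_submatrix_mul _ _ _
      · exact vecMul_one_submatrix_mul _ _ _
    · exact (vecMul_one_submatrix_mul _ _ _).trans (Matrix.vecMul_one _)
  simp only [hV, Matrix.vecMul_one, htrOne] at hΓ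
  simp only [hV] at hG
  have key := tendsto_fMeasure_estimate hs hX j (hR j)
    (H := fun n => ![(fun i => gB n i ω) ᵥ* (S 0 n ⊗ₖ M), (fun i => gA n i ω) ᵥ* (S 1 n ⊗ₖ M)])
    (Z := fun n i => Z n i ω) hΓ
    (K := (2 * L + 2 * s) * (max (C * ‖M‖) 1 * (C' * ‖B‖) * max (C * ‖M‖) 1))
    (fun n a => (norm_trace_mul_mul_conjTranspose_le (hT n a) (hQ n)).trans (by
      calc _ ≤ (2 * L + 2 * s : ℝ) * n *
            (max (C * ‖M‖) 1 * (C' * ‖B‖) * max (C * ‖M‖) 1) := by gcongr; exact hcard n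
        _ = _ := by ring)) hG
  simp only [htr] at key
  exact key

end received

end PilotID

/-! ### Assembly of the two situations. -/

open PilotID in
theorem theorem3 {Ω : Type*} [MeasurableSpace Ω] (μ : Measure Ω) [IsProbabilityMeasure μ]
    -- array and scattering geometry
    (D Δ θ₁ θ₂ : ℝ) (hD : 0 < D) (hΔ : 0 < Δ)
    (hθ₁ : -(Real.pi / 3) ≤ θ₁ - Δ ∧ θ₁ + Δ ≤ Real.pi / 3)
    (hθ₂ : -(Real.pi / 3) ≤ θ₂ - Δ ∧ θ₂ + Δ ≤ Real.pi / 3)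
    -- paths, and overlapping subcarriers out of `N`
    (N L s : ℕ) (hL : 0 < L) (hs : L ≤ s) (p : Fin s → Fin N) (hp : Function.Injective p)
    -- eigenvalue thresholds
    (τ : ℕ → ℝ) (c : ℝ) (hc : 0 < c) (hτ : ∀ n, c ≤ τ n)
    -- channel coefficients of Bob and Ava with `n` antennas
    (gB gA : ∀ n : ℕ, Fin n × Fin L → Ω → ℂ) :
    -- the estimates obtained from the received signal, for many antennas and high SNR
    (∀ (ρB ρA : ℝ) (φ ψ : Fin 2 → ℝ) (Z : ∀ n : ℕ, Fin 2 × (Fin n × Fin s) → Ω → ℂ),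
      0 < ρB → 0 < ρA → (pilots ρB ρA φ ψ).det ≠ 0 →
      (∀ n, IsIIDCN (Sum.elim (gB n) (Sum.elim (gA n) (Z n))) μ) →
      ∀ᵐ ω ∂μ, Tendsto
        (fun q : ℕ × ℝ =>
          let R1 := ringCov D Δ L θ₁ q.1
          let R2 := ringCov D Δ L θ₂ q.1
          let hR1 : R1.IsHermitian := ringCov_isHermitian D Δ L θ₁ q.1
          let hR2 : R2.IsHermitian := ringCov_isHermitian D Δ L θ₂ q.1
          let F := dftRows N L p
          let X := pilots ρB ρA φ ψ
          let hB := fsChannel hR1 F (fun i => gB q.1 i ω)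
          let hA := fsChannel hR2 F (fun i => gA q.1 i ω)
          let Y := received X hB hA q.2 (fun i => Z q.1 i ω)
          let hatB := estimate R1 (freqCov F) (fun k => X k 0) Y
          let hatA := estimate R2 (freqCov F) (fun k => X k 1) Y
          (deltaF hR1 (τ q.1) F hatB hatA - deltaFLimit L hR1 (τ q.1) R2)
            / ((q.1 : ℂ) * (s : ℂ)))
        (atTop ×ˢ 𝓝[≥] 0) (𝓝 0)) ∧
    -- estimates with Gaussian errors of equal, possibly non-vanishing, mean square
    (∀ (ε : ℕ → ℝ) (M : ℝ) (wB wA : ∀ n : ℕ, Fin n × Fin s → Ω → ℂ),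
      (∀ n, |ε n| ≤ M) →
      (∀ n, IsIIDCN (Sum.elim (gB n) (wB n)) μ) →
      (∀ n, IsIIDCN (Sum.elim (gA n) (wA n)) μ) →
      ∀ᵐ ω ∂μ, Tendsto
        (fun n : ℕ =>
          let R1 := ringCov D Δ L θ₁ n
          let R2 := ringCov D Δ L θ₂ n
          let hR1 : R1.IsHermitian := ringCov_isHermitian D Δ L θ₁ n
          let hR2 : R2.IsHermitian := ringCov_isHermitian D Δ L θ₂ n
          let F := dftRows N L p
          let hatB := fsChannel hR1 F (fun i => gB n i ω) - (ε n : ℂ) • (fun i => wB n i ω)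
          let hatA := fsChannel hR2 F (fun i => gA n i ω) - (ε n : ℂ) • (fun i => wA n i ω)
          (deltaF hR1 (τ n) F hatB hatA - deltaFLimit L hR1 (τ n) R2)
            / ((n : ℂ) * (s : ℂ)))
        atTop (𝓝 0)) := by
  have hs0 : 0 < s := hL.trans_le hs
  have hs' : (s : ℂ) ≠ 0 := by exact_mod_cast hs0.ne'
  have hL' : (L : ℂ) ≠ 0 := by exact_mod_cast hL.ne'
  obtain ⟨K₁, hK₁⟩ := exists_eigenvalues_ringCov_le hD hΔ hθ₁ L
  obtain ⟨K₂, hK₂⟩ := exists_eigenvalues_ringCov_le hD hΔ hθ₂ L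
  have hS₁ := fun n => norm_hermSqrt_le (ringCov_isHermitian D Δ L θ₁ n) (fun i => (hK₁ n i).2)
  have hS₂ := fun n => norm_hermSqrt_le (ringCov_isHermitian D Δ L θ₂ n) (fun i => (hK₂ n i).2)
  have hA := fun n => norm_truncInv_le (ringCov_isHermitian D Δ L θ₁ n) hc (hτ n)
  have ht₁ : ∀ n, ((hermSqrt (ringCov_isHermitian D Δ L θ₁ n) ⊗ₖ (dftRows N L p)ᵀ) *
      (truncInv (ringCov_isHermitian D Δ L θ₁ n) (τ n) ⊗ₖ
        pseudoInv (freqCov_isHermitian (dftRows N L p))) *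
      (hermSqrt (ringCov_isHermitian D Δ L θ₁ n) ⊗ₖ (dftRows N L p)ᵀ)ᴴ).trace =
        (L : ℂ) * effRank (ringCov_isHermitian D Δ L θ₁ n) (τ n) := fun n => by
    rw [trace_channel_pseudoInv hs hp, trace_hermSqrt_truncInv _ (hc.trans_le (hτ n))]
  have ht₂ : ∀ n, ((hermSqrt (ringCov_isHermitian D Δ L θ₂ n) ⊗ₖ (dftRows N L p)ᵀ) *
      (truncInv (ringCov_isHermitian D Δ L θ₁ n) (τ n) ⊗ₖ
        pseudoInv (freqCov_isHermitian (dftRows N L p))) *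
      (hermSqrt (ringCov_isHermitian D Δ L θ₂ n) ⊗ₖ (dftRows N L p)ᵀ)ᴴ).trace =
        (L : ℂ) * (ringCov D Δ L θ₂ n *
          truncInv (ringCov_isHermitian D Δ L θ₁ n) (τ n)).trace := fun n => by
    rw [trace_channel_pseudoInv hs hp, trace_hermSqrt_mul_mul _ fun i => (hK₂ n i).1]
  have hR : ∀ (θ : ℝ) (n : ℕ), 0 < n → (ringCov D Δ L θ n).trace *
      (freqCov (dftRows N L p)).trace / ((n : ℂ) * s) = 1 := fun θ n hn => by
    have hn' : (n : ℂ) ≠ 0 := by exact_mod_cast hn.ne'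
    rw [trace_ringCov hΔ, trace_freqCov_dftRows]
    field_simp
  refine ⟨fun ρB ρA φ ψ Z _ _ hdet hiid => ?_, fun ε M wB wA hε hB hA' => ?_⟩
  · filter_upwards [tendsto_fMeasure_received hs0 hiid hdet
      (R := ![fun n => ringCov D Δ L θ₁ n, fun n => ringCov D Δ L θ₂ n])
      (S := ![fun n => hermSqrt (ringCov_isHermitian D Δ L θ₁ n),
        fun n => hermSqrt (ringCov_isHermitian D Δ L θ₂ n)])
      (C := max √K₁ √K₂)
      (fun j n => by
        fin_cases j
        · exact (hS₁ n).trans (le_max_left _ _)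
        · exact (hS₂ n).trans (le_max_right _ _))
      hA (pseudoInv (freqCov_isHermitian (dftRows N L p))) (freqCov (dftRows N L p))
      (M := (dftRows N L p)ᵀ)
      (fun j n hn => by
        fin_cases j
        · exact hR θ₁ n hn
        · exact hR θ₂ n hn)
      (fun j n => by
        fin_cases j
        · exact trace_channel_gram hΔ hL fun i => (hK₁ n i).1
        · exact trace_channel_gram hΔ hL fun i => (hK₂ n i).1)] with ω hω
    have h := ((hω 0).sub (hω 1)).div_const (s : ℂ)
    rw [sub_zero, zero_div] at h
    refine h.congr fun q => ?_
    simp only [Matrix.cons_val_zero, Matrix.cons_val_one, ht₁, ht₂]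
    simp only [deltaF, deltaFLimit, fsChannel]
    ring
  · filter_upwards [tendsto_fMeasure_channel_sub_noise hB hS₁ hA (dftRows N L p)ᵀ
        (pseudoInv (freqCov_isHermitian (dftRows N L p))) hε,
      tendsto_fMeasure_channel_sub_noise hA' hS₂ hA (dftRows N L p)ᵀ
        (pseudoInv (freqCov_isHermitian (dftRows N L p))) hε] with ω h₁ h₂
    -- The error means `ε² tr(R̄₁ ⊗ R̄_F)` are identical for both users and cancel here, however
    -- large the bounded `ε`.
    have h := (h₁.sub h₂).div_const (s : ℂ)
    rw [sub_zero, zero_div] at h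
    refine h.congr fun n => ?_
    simp only [ht₁, ht₂]
    simp only [deltaF, deltaFLimit, fsChannel]
    ring
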